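/- Let $0<q<1$, let $v>-1$ be real, and let $a=q^N$ with $N\in\mathbb Z$. Put $\mathbb R_q=\{\pm q^n: n\in\mathbb Z\}$, $[0,a]_q=\{q^s: s\in\mathbb Z,\ s\ge N\}$, and $$\int_0^a g(x)\,d_qx=(1-q)\,a\sum_{n\ge 0}q^n g(aq^n),\qquad \int_0^\infty g(x)\,d_qx=(1-q)\sum_{n\in\mathbb Z}q^n g(q^n).$$ With $(z;q)_n=\prod_{i=0}^{n-1}(1-zq^i)$ for $n\in\mathbb N\cup\{\infty\}$, let $$j_v(z,q^2)=\sum_{n\ge0}(-1)^n\frac{q^{n(n+1)}}{(q^2;q^2)_n(q^{2v+2};q^2)_n}z^{2n},\qquad c_{q,v}=\frac1{1-q}\,\frac{(q^{2v+2};q^2)_\infty}{(q^2;q^2)_\infty}.$$ Let $\mathcal L_{q,2,v}$ be the space of even functions $f:\mathbb R_q\to\mathbb R$ with $\|f\|^2=\int_0^\infty |f(x)|^2x^{2v+1}d_qx<\infty$, with inner product $\langle f,g\rangle=\int_0^\infty f(t)g(t)t^{2v+1}d_qt$, and let $\mathcal L_{q,v,a}$ be the space of functions on $[0,a]_q$ with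 $\int_0^a|u(x)|^2x^{2v+1}d_qx<\infty$, with inner product $\int_0^a u(t)w(t)t^{2v+1}d_qt$. Let $PW_{q,a}^v$ be the set of functions on $\mathbb R_q$ of the form $f(x)=\int_0^a u(t)\,j_v(xt,q^2)\,t^{2v+1}d_qt$ with $u\in\mathcal L_{q,2,v}$ vanishing outside $[-a,a]$; then $PW_{q,a}^v\subset\mathcal L_{q,2,v}$. For $f\in PW_{q,a}^v$, $f\ne0$, let $$\theta_a^vf=\frac{\int_0^a f(x)^2x^{2v+1}d_qx}{\|f\|^2}.$$ Let $T_a^vu(x)=c_{q,v}\int_0^a u(t)\,j_v(xt,q^2)\,t^{2v+1}d_qt$, as an operator on $\mathcal L_{q,v,a}$, and let $(\psi_i)_{i\in\mathbb N}$ be the $q$-prolate spheroidal wave functions: a sequence of eigenfunctions, $T_a^v\psi_i=\lambda_i\psi_i$, mutually orthogonal in $\mathcal L_{q,v,a}$, such that no eigenfunction of $T_a^v$ is orthogonal to all of them, listed so that $|\lambda_0|\ge|\lambda_1|\ge\cdots$, extended to $\mathbb R_q$ by $\psi_i(x)=\frac1{\lambda_i}T_a^v\psi_i(x)$, and normalized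 by $\langle\psi_i,\psi_i\rangle=1$. Such sequences exist, and every such sequence has the following properties. 1. $\psi_0\in PW_{q,a}^v$, $\psi_0\neq 0$, and the maximum of $\theta_a^vf$ over nonzero $f\in PW_{q,a}^v$ is attained at $f=\psi_0$ and equals $\lambda_0^2$. 2. For every $n\ge0$ and every nonzero $f\in\operatorname{span}\{\psi_0,\dots,\psi_n\}$ (these $f$ lie in $PW_{q,a}^v$), $$\theta_a^vf=\frac{\sum_{i=0}^n\lambda_i^2\langle f,\psi_i\rangle^2}{\sum_{i=0}^n\langle f,\psi_i\rangle^2}\ \ge\ \lambda_n^2 .$$ 3. For every $n\ge0$ and every nonzero $f\in PW_{q,a}^v$ orthogonal to $\operatorname{span}\{\psi_0,\dots,\psi_n\}$, $$\theta_a^vf=\frac{\sum_{i=n+1}^\infty\lambda_i^2\langle f,\psi_i\rangle^2}{\sum_{i=n+1}^\infty\langle f,\psi_i\rangle^2}\ \le\ \lambda_{n+1}^2 ,$$ where both series converge. -/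

import Mathlib

noncomputable section

namespace QProlate

/-- The set `ℝ_q = {± q ^ n : n ∈ ℤ}`. -/
def Rq (q : ℝ) : Set ℝ := {x | ∃ n : ℤ, x = q ^ n ∨ x = -q ^ n}

/-- The point `q ^ n` of `ℝ_q`. -/
def pt (q : ℝ) (n : ℤ) : Rq q := ⟨q ^ n, n, Or.inl rfl⟩

/-- The finite `q`-shifted factorial `(z; q)_n`. -/
def qPoch (z q : ℝ) (n : ℕ) : ℝ := ∏ i ∈ Finset.range n, (1 - z * q ^ i)

/-- The infinite `q`-shifted factorial `(z; q)_∞`. -/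
def qPochInf (z q : ℝ) : ℝ := ∏' i : ℕ, (1 - z * q ^ i)

/-- The normalized Hahn-Exton `q`-Bessel function `j_v(z, q)`. -/
def hahnExton (v z q : ℝ) : ℝ :=
  ∑' n : ℕ, (-1) ^ n * (q ^ (n * (n + 1) / 2) / (qPoch q q n * qPoch (q ^ (v + 1)) q n))
    * z ^ (2 * n)

/-- Jackson's integral from `0` to `a = q ^ N` of a function on `ℝ_q`:
`(1 - q) a ∑_{n ≥ 0} q ^ n g(a q ^ n)`. -/
def jackson (q : ℝ) (N : ℤ) (g : Rq q → ℝ) : ℝ :=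
  (1 - q) * q ^ N * ∑' n : ℕ, q ^ n * g (pt q (N + n))

/-- Jackson's integral from `0` to `∞` of a function on `ℝ_q`:
`(1 - q) ∑_{n ∈ ℤ} q ^ n g(q ^ n)`. -/
def jacksonInf (q : ℝ) (g : Rq q → ℝ) : ℝ :=
  (1 - q) * ∑' n : ℤ, q ^ n * g (pt q n)

/-- The space `L_{q,2,v}`: even functions on `ℝ_q` with
`∫_0^∞ |f(x)|² x^(2v+1) d_q x < ∞`. -/
def MemL2 (q v : ℝ) (f : Rq q → ℝ) : Prop :=
  (∀ x y : Rq q, (y : ℝ) = -x → f y = f x) ∧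
  Summable fun n : ℤ => q ^ n * (|f (pt q n)| ^ 2 * ((pt q n : ℝ)) ^ (2 * v + 1))

/-- `⟨f, g⟩ = ∫_0^∞ f(t) g(t) t^(2v+1) d_q t`. -/
def qInner (q v : ℝ) (f g : Rq q → ℝ) : ℝ :=
  jacksonInf q fun t => f t * g t * (t : ℝ) ^ (2 * v + 1)

/-- The norm `‖f‖_{q,2,v}`. -/
def qNorm (q v : ℝ) (f : Rq q → ℝ) : ℝ :=
  Real.sqrt (jacksonInf q fun x => |f x| ^ 2 * (x : ℝ) ^ (2 * v + 1))

/-- `∫_0^a f(t) g(t) t^(2v+1) d_q t`, where `a = q ^ N`: the inner product of `L_{q,v,a}`. -/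
def qInnerOn (q v : ℝ) (N : ℤ) (f g : Rq q → ℝ) : ℝ :=
  jackson q N fun t => f t * g t * (t : ℝ) ^ (2 * v + 1)

/-- The restriction of `u` to `[0,a]_q = {q ^ s : s ≥ N}` belongs to `L_{q,v,a}`, that is,
`∫_0^a |u(x)|² x^(2v+1) d_q x < ∞`. Only values of `u` on `[0,a]_q` occur. -/
def MemL2On (q v : ℝ) (N : ℤ) (u : Rq q → ℝ) : Prop :=
  Summable fun n : ℕ =>
    q ^ n * (|u (pt q (N + n))| ^ 2 * ((pt q (N + n) : ℝ)) ^ (2 * v + 1))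

/-- The subspace of `L_{q,2,v}` of the (even) functions that vanish outside `[-a, a]`,
`a = q ^ N`: the image of `L_{q,v,a}` under its natural embedding. -/
def MemL2Supp (q v : ℝ) (N : ℤ) (u : Rq q → ℝ) : Prop :=
  MemL2 q v u ∧ ∀ x : Rq q, q ^ N < |(x : ℝ)| → u x = 0

/-- The constant `c_{q,v}`. -/
def cqv (q v : ℝ) : ℝ :=
  1 / (1 - q) * (qPochInf (q ^ (2 * v + 2)) (q ^ 2) / qPochInf (q ^ 2) (q ^ 2))

/-- `T_a^v u(x) = c_{q,v} ∫_0^a u(t) j_v(xt, q²) t^(2v+1) d_q t`, where `a = q ^ N`.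
The formula makes sense for all `x` in `ℝ_q` and involves only values of `u` on `[0,a]_q`. -/
def T (q v : ℝ) (N : ℤ) (u : Rq q → ℝ) (x : Rq q) : ℝ :=
  cqv q v * jackson q N fun t =>
    u t * hahnExton v ((x : ℝ) * t) (q ^ 2) * (t : ℝ) ^ (2 * v + 1)

/-- The `q`-Paley-Wiener space `PW_{q,a}^v`, where `a = q ^ N`. -/
def PW (q v : ℝ) (N : ℤ) : Set (Rq q → ℝ) :=
  {f | ∃ u : Rq q → ℝ, MemL2Supp q v N u ∧ ∀ x : Rq q,
    f x = jackson q N fun t => u t * hahnExton v ((x : ℝ) * t) (q ^ 2) * (t : ℝ) ^ (2 * v + 1)}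

/-- (The restriction to `[0,a]_q` of) `u` is an eigenfunction, with eigenvalue `μ`, of the
operator `T_a^v` acting on `L_{q,v,a}`. -/
def IsEigenfunction (q v : ℝ) (N : ℤ) (μ : ℝ) (u : Rq q → ℝ) : Prop :=
  MemL2On q v N u ∧ (∃ s : ℤ, N ≤ s ∧ u (pt q s) ≠ 0) ∧
  ∀ s : ℤ, N ≤ s → T q v N u (pt q s) = μ * u (pt q s)

/-- `ψ 0, ψ 1, …` are the `q`-prolate spheroidal wave functions with eigenvalues
`lam 0, lam 1, …`: a full orthogonal sequence of eigenfunctions of `T_a^v` on `L_{q,v,a}`, in the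
order of decreasing absolute values of the eigenvalues, extended from `[0,a]_q` to `ℝ_q`
and normalized in `L_{q,2,v}`. -/
structure IsProlateSystem (q v : ℝ) (N : ℤ) (lam : ℕ → ℝ) (ψ : ℕ → Rq q → ℝ) : Prop where
  /-- each `ψ i` is an eigenfunction -/
  eigen : ∀ i, IsEigenfunction q v N (lam i) (ψ i)
  /-- they are mutually orthogonal in `L_{q,v,a}` -/
  orth : ∀ i j, i ≠ j → qInnerOn q v N (ψ i) (ψ j) = 0
  /-- all eigenfunctions are accounted for: none is orthogonal to every `ψ i` -/
  full : ∀ (μ : ℝ) (u : Rq q → ℝ), IsEigenfunction q v N μ u →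
    ∃ i, qInnerOn q v N u (ψ i) ≠ 0
  /-- the eigenvalues are listed by decreasing absolute value -/
  order : ∀ i j, i ≤ j → |lam j| ≤ |lam i|
  /-- the extension of `ψ i` to `ℝ_q` -/
  extend : ∀ i (x : Rq q), ψ i x = 1 / lam i * T q v N (ψ i) x
  /-- the normalization -/
  unit : ∀ i, qInner q v (ψ i) (ψ i) = 1

/-- The concentration index
`θ_a^v f = ∫_0^a f(x)² x^(2v+1) d_q x / ‖f‖²_{q,2,v}`, where `a = q ^ N`. -/
def theta (q v : ℝ) (N : ℤ) (f : Rq q → ℝ) : ℝ :=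
  (jackson q N fun x => f x ^ 2 * (x : ℝ) ^ (2 * v + 1)) / qNorm q v f ^ 2

end QProlate

end

noncomputable section

open Filter Topology

namespace QProlate

/-! ### Infinite `q`-shifted factorials -/

/-! Put p = q², r = q^(v+1), both in (0,1). Weighting the value of f at q^n by √(1-q) r^n turns
L_{q,2,v} into ℓ²(ℤ) and L_{q,v,a} into ℓ²(ℕ), an index n standing for the point q^(N+n). In these
coordinates the integral operator has a matrix `kernel p r (k + m)` that depends only on the sum of
its indices (`wt_mul_T_pt`).

The numbers `kernel p r k` are the Laurent coefficients of F(s) = (r/s; p)_∞ / (rs; p)_∞, and F(s)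
F(1/s) = 1. Hence the columns of the matrix are orthonormal (`tsum_kernel_mul_kernel`), and the
transform of functions living on [0,a]_q is an isometry G : ℓ²(ℕ) → ℓ²(ℤ). Its range is the
Paley-Wiener space (`IsHankelPair.mem_PW_iff`). The operator T_a^v is the truncation T of G to the
indices ≥ N. It is symmetric, it is compact because the kernel is O(r^k), and it is injective
because (GU)(k) is r^k times an entire function of p^k, whose zeros cannot accumulate at 0
(`eq_zero_of_hankel_eq_zero`).

For f = GU the concentration index is therefore the quotient ‖TU‖² / ‖U‖² (`IsHankelPair.theta_eq`).
The prolate functions are ψ_i = G e_i for an orthonormal basis e_i of eigenvectors of T, and ⟨f,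
ψ_i⟩ = ⟨U, e_i⟩. Parseval's identity for U and for TU gives the three variational statements.
Existence of a system is the spectral theorem; that an arbitrary system is complete follows because
a nonzero invariant complement would contain one more eigenvector. -/

theorem qPoch_succ (z p : ℝ) (n : ℕ) : qPoch z p (n + 1) = qPoch z p n * (1 - z * p ^ n) := by
  simp [qPoch, Finset.prod_range_succ]

theorem qPoch_pos {z p : ℝ} (hp0 : 0 < p) (hp1 : p < 1) (hz : z < 1) (n : ℕ) :
    0 < qPoch z p n := by
  refine Finset.prod_pos fun i _ => ?_
  have h1 : p ^ i ≤ 1 := pow_le_one₀ hp0.le hp1.le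
  have h2 : 0 < p ^ i := pow_pos hp0 i
  rcases le_or_gt z 0 with h | h <;> nlinarith

theorem qPoch_le_one {z p : ℝ} (hp0 : 0 < p) (hp1 : p < 1) (hz0 : 0 ≤ z) (hz : z < 1) (n : ℕ) :
    qPoch z p n ≤ 1 := by
  refine Finset.prod_le_one (fun i _ => ?_) (fun i _ => ?_)
  · have h1 : p ^ i ≤ 1 := pow_le_one₀ hp0.le hp1.le
    have h2 : 0 < p ^ i := pow_pos hp0 i
    nlinarith
  · have h2 : 0 < p ^ i := pow_pos hp0 i
    nlinarith

theorem summable_norm_mul_pow {p : ℝ} (hp0 : 0 < p) (hp1 : p < 1) (z : ℝ) :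
    Summable fun i : ℕ => ‖-(z * p ^ i)‖ := by
  simp only [norm_neg, norm_mul, norm_pow, Real.norm_eq_abs, abs_of_pos hp0]
  exact (summable_geometric_of_lt_one hp0.le hp1).mul_left _

theorem multipliable_qPoch {p : ℝ} (hp0 : 0 < p) (hp1 : p < 1) (z : ℝ) :
    Multipliable fun i : ℕ => 1 - z * p ^ i := by
  simpa [sub_eq_add_neg] using multipliable_one_add_of_summable (summable_norm_mul_pow hp0 hp1 z)

theorem tendsto_qPoch {p : ℝ} (hp0 : 0 < p) (hp1 : p < 1) (z : ℝ) :
    Tendsto (qPoch z p) atTop (𝓝 (qPochInf z p)) :=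
  (multipliable_qPoch hp0 hp1 z).hasProd.tendsto_prod_nat

theorem qPochInf_eq_mul {p : ℝ} (hp0 : 0 < p) (hp1 : p < 1) (z : ℝ) (n : ℕ) :
    qPochInf z p = qPoch z p n * qPochInf (z * p ^ n) p := by
  have e : ∀ i : ℕ, 1 - z * p ^ n * p ^ i = 1 - z * p ^ (i + n) := fun i => by ring
  have h : Multipliable fun i : ℕ => 1 - z * p ^ (i + n) :=
    (multipliable_qPoch hp0 hp1 (z * p ^ n)).congr e
  have h' := Multipliable.prod_mul_tprod_nat_mul' (f := fun i : ℕ => 1 - z * p ^ i) h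
  rw [qPochInf, ← h', qPoch, qPochInf, tprod_congr e]

theorem qPochInf_pos {z p : ℝ} (hp0 : 0 < p) (hp1 : p < 1) (hz : z < 1) : 0 < qPochInf z p := by
  refine lt_of_le_of_ne (ge_of_tendsto' (tendsto_qPoch hp0 hp1 z)
    fun n => (qPoch_pos hp0 hp1 hz n).le) (Ne.symm ?_)
  -- The limit of positive partial products is only nonnegative; it is nonzero because the product
  -- converges absolutely and has no zero factor.
  have h := tprod_one_add_ne_zero_of_summable (f := fun i : ℕ => -(z * p ^ i)) (fun i => ?_)
    (summable_norm_mul_pow hp0 hp1 z)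
  · simpa [sub_eq_add_neg, qPochInf] using h
  · have h1 : p ^ i ≤ 1 := pow_le_one₀ hp0.le hp1.le
    have h2 : 0 < p ^ i := pow_pos hp0 i
    rcases le_or_gt z 0 with h | h <;> nlinarith

theorem qPochInf_le_qPoch {z p : ℝ} (hp0 : 0 < p) (hp1 : p < 1) (hz0 : 0 ≤ z) (hz : z < 1)
    (n : ℕ) : qPochInf z p ≤ qPoch z p n := by
  have h2 : p ^ n ≤ 1 := pow_le_one₀ hp0.le hp1.le
  have h3 : 0 < p ^ n := pow_pos hp0 n
  have h4 : z * p ^ n < 1 := by nlinarith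
  have h1 : qPochInf (z * p ^ n) p ≤ 1 :=
    le_of_tendsto' (tendsto_qPoch hp0 hp1 _)
      fun m => qPoch_le_one hp0 hp1 (mul_nonneg hz0 h3.le) h4 m
  rw [qPochInf_eq_mul hp0 hp1 z n]
  nlinarith [qPoch_pos hp0 hp1 hz n]

/-! ### Euler's expansion -/

/-- The coefficients of Euler's expansion of `(x; p)_∞`. -/
def eulerCoeff (p : ℝ) (n : ℕ) : ℝ := (-1) ^ n * p ^ n.choose 2 / qPoch p p n

theorem qPoch_self_ne_zero {p : ℝ} (hp0 : 0 < p) (hp1 : p < 1) (n : ℕ) : qPoch p p n ≠ 0 :=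
  (qPoch_pos hp0 hp1 hp1 n).ne'

theorem one_sub_pow_succ_ne_zero {p : ℝ} (hp0 : 0 < p) (hp1 : p < 1) (n : ℕ) :
    1 - p ^ (n + 1) ≠ 0 :=
  (sub_pos.2 (pow_lt_one₀ hp0.le hp1 n.succ_ne_zero)).ne'

/-- This is the coefficient form of E(x) = (1 - x) E(px), the functional equation of (x; p)_∞. -/
theorem eulerCoeff_succ {p : ℝ} (hp0 : 0 < p) (hp1 : p < 1) (n : ℕ) :
    eulerCoeff p (n + 1) * (1 - p ^ (n + 1)) = -p ^ n * eulerCoeff p n := by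
  have h1 := qPoch_self_ne_zero hp0 hp1 n
  have h2 := one_sub_pow_succ_ne_zero hp0 hp1 n
  have h3 : (n + 1).choose 2 = n + n.choose 2 := by
    simp [Nat.choose_succ_succ' n 1]
  rw [eulerCoeff, eulerCoeff, qPoch_succ, h3, ← pow_succ' p n]
  field_simp
  ring

theorem summable_eulerCoeff_mul_pow {p : ℝ} (hp0 : 0 < p) (hp1 : p < 1) (x : ℝ) :
    Summable fun n : ℕ => ‖eulerCoeff p n * x ^ n‖ := by
  refine summable_of_ratio_norm_eventually_le (r := 1 / 2) (by norm_num) ?_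
  have h : Tendsto (fun n : ℕ => p ^ n * |x|) atTop (𝓝 (0 * |x|)) :=
    (tendsto_pow_atTop_nhds_zero_of_lt_one hp0.le hp1).mul_const _
  rw [zero_mul] at h
  -- The ratio of consecutive terms is p^n |x| / (1 - p^(n+1)), with denominator at least 1 - p; the
  -- threshold (1 - p)/2 makes it at most 1/2.
  filter_upwards [h.eventually_lt_const (show (0 : ℝ) < (1 - p) / 2 by linarith)] with n hn
  have h1 : 1 - p ≤ 1 - p ^ (n + 1) := by
    have : p ^ (n + 1) ≤ p := by
      simpa using pow_le_pow_of_le_one hp0.le hp1.le (show 1 ≤ n + 1 by omega)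
    linarith
  have h2 : |eulerCoeff p (n + 1)| * (1 - p ^ (n + 1)) = p ^ n * |eulerCoeff p n| := by
    have := congrArg abs (eulerCoeff_succ hp0 hp1 n)
    rwa [abs_mul, abs_mul, abs_neg, abs_of_pos (show 0 < 1 - p ^ (n + 1) by linarith),
      abs_of_pos (pow_pos hp0 n)] at this
  have h3 : (1 - p) * (|eulerCoeff p (n + 1)| * |x| ^ (n + 1)) ≤
      (1 - p) * (1 / 2 * (|eulerCoeff p n| * |x| ^ n)) :=
    calc (1 - p) * (|eulerCoeff p (n + 1)| * |x| ^ (n + 1))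
        ≤ (1 - p ^ (n + 1)) * (|eulerCoeff p (n + 1)| * |x| ^ (n + 1)) := by gcongr
      _ = (|eulerCoeff p (n + 1)| * (1 - p ^ (n + 1))) * |x| ^ (n + 1) := by ring
      _ = (p ^ n * |x|) * (|eulerCoeff p n| * |x| ^ n) := by rw [h2]; ring
      _ ≤ (1 - p) / 2 * (|eulerCoeff p n| * |x| ^ n) := by gcongr
      _ = _ := by ring
  simpa [abs_mul] using le_of_mul_le_mul_left h3 (by linarith)

theorem eulerCoeff_zero (p : ℝ) : eulerCoeff p 0 = 1 := by simp [eulerCoeff, qPoch]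

theorem tsum_eulerCoeff_functional_eq {p : ℝ} (hp0 : 0 < p) (hp1 : p < 1) (x : ℝ) :
    ∑' n, eulerCoeff p n * x ^ n = (1 - x) * ∑' n, eulerCoeff p n * (x * p) ^ n := by
  have s1 := (summable_eulerCoeff_mul_pow hp0 hp1 x).of_norm
  have s2 := (summable_eulerCoeff_mul_pow hp0 hp1 (x * p)).of_norm
  have key : ∀ n, eulerCoeff p (n + 1) * x ^ (n + 1) =
      eulerCoeff p (n + 1) * (x * p) ^ (n + 1) - x * (eulerCoeff p n * (x * p) ^ n) := by
    intro n
    have := eulerCoeff_succ hp0 hp1 n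
    linear_combination x ^ (n + 1) * this
  rw [s1.tsum_eq_zero_add, tsum_congr key, Summable.tsum_sub ((summable_nat_add_iff 1).2 s2)
    (s2.mul_left x), tsum_mul_left, sub_mul, one_mul]
  conv_rhs => rw [s2.tsum_eq_zero_add]
  rw [s2.tsum_eq_zero_add]
  simp
  ring

/-- Iterating the functional equation gives E(x) = (x; p)_n E(x p^n), and E(x p^n) → E(0) = 1. -/
theorem tsum_eulerCoeff {p : ℝ} (hp0 : 0 < p) (hp1 : p < 1) (x : ℝ) :
    ∑' n, eulerCoeff p n * x ^ n = qPochInf x p := by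
  set E : ℝ → ℝ := fun x => ∑' n, eulerCoeff p n * x ^ n with hE
  have hiter : ∀ n, E x = qPoch x p n * E (x * p ^ n) := by
    intro n
    induction n with
    | zero => simp [qPoch]
    | succ n ih =>
      rw [ih, qPoch_succ, hE]
      simp only
      rw [tsum_eulerCoeff_functional_eq hp0 hp1 (x * p ^ n)]
      ring_nf
  have hcont : Tendsto (fun n : ℕ => E (x * p ^ n)) atTop (𝓝 (∑' n, if n = 0 then (1 : ℝ) else 0)) := by
    refine tendsto_tsum_of_dominated_convergence (summable_eulerCoeff_mul_pow hp0 hp1 x) ?_ ?_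
    · intro k
      rcases k with _ | k
      · simp [eulerCoeff_zero]
      · have h1 : Tendsto (fun n : ℕ => x * p ^ n) atTop (𝓝 (x * 0)) :=
          (tendsto_pow_atTop_nhds_zero_of_lt_one hp0.le hp1).const_mul _
        simpa using (h1.pow (k + 1)).const_mul (eulerCoeff p (k + 1))
    · refine Eventually.of_forall fun n k => ?_
      have h1 : |p ^ n| ≤ 1 := by
        rw [abs_of_pos (pow_pos hp0 n)]; exact pow_le_one₀ hp0.le hp1.le
      rw [mul_pow, ← mul_assoc, norm_mul]
      refine mul_le_of_le_one_right (norm_nonneg _) ?_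
      rw [norm_pow, Real.norm_eq_abs]
      exact pow_le_one₀ (abs_nonneg _) h1
  rw [tsum_ite_eq] at hcont
  have h2 := (tendsto_qPoch hp0 hp1 x).mul hcont
  rw [mul_one] at h2
  exact tendsto_nhds_unique (tendsto_const_nhds.congr hiter) h2

/-! ### The inverse power series -/

/-- The generating series satisfy A(X) = (1 - X) A(pX) and B(pX) = (1 - X) B(X). So AB is invariant
under X ↦ pX, and its coefficients of positive degree vanish since p^(n+1) ≠ 1. -/
theorem sum_antidiagonal_eulerCoeff {p : ℝ} (hp0 : 0 < p) (hp1 : p < 1) (n : ℕ) :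
    ∑ ij ∈ Finset.HasAntidiagonal.antidiagonal n, eulerCoeff p ij.1 * (1 / qPoch p p ij.2) =
      if n = 0 then 1 else 0 := by
  set A : PowerSeries ℝ := PowerSeries.mk fun n => eulerCoeff p n
  set B : PowerSeries ℝ := PowerSeries.mk fun n => 1 / qPoch p p n
  have hA : A = (1 - PowerSeries.X) * PowerSeries.rescale p A := by
    ext n
    rcases n with _ | n
    · rw [sub_mul, one_mul, map_sub, PowerSeries.coeff_zero_X_mul]
      simp [A, -PowerSeries.coeff_zero_eq_constantCoeff]
    · rw [sub_mul, one_mul, map_sub, PowerSeries.coeff_succ_X_mul]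
      simp only [A, PowerSeries.coeff_mk, PowerSeries.coeff_rescale]
      linear_combination eulerCoeff_succ hp0 hp1 n
  have hB : PowerSeries.rescale p B = (1 - PowerSeries.X) * B := by
    ext n
    rcases n with _ | n
    · rw [sub_mul, one_mul, map_sub, PowerSeries.coeff_zero_X_mul]
      simp [B, -PowerSeries.coeff_zero_eq_constantCoeff]
    · rw [sub_mul, one_mul, map_sub, PowerSeries.coeff_succ_X_mul]
      simp only [B, PowerSeries.coeff_mk, PowerSeries.coeff_rescale]
      have h1 := qPoch_self_ne_zero hp0 hp1 n
      have h2 := one_sub_pow_succ_ne_zero hp0 hp1 n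
      rw [qPoch_succ, ← pow_succ' p n]
      field_simp
      ring
  have hAB : PowerSeries.rescale p (A * B) = A * B := by
    rw [map_mul, hB]
    conv_rhs => rw [hA]
    ring
  have hc : PowerSeries.coeff n (A * B) =
      ∑ ij ∈ Finset.HasAntidiagonal.antidiagonal n, eulerCoeff p ij.1 * (1 / qPoch p p ij.2) := by
    simp [PowerSeries.coeff_mul, A, B]
  rcases n with _ | n
  · simp [eulerCoeff_zero, qPoch]
  · rw [← hc, if_neg n.succ_ne_zero]
    have h := congrArg (PowerSeries.coeff (n + 1)) hAB
    rw [PowerSeries.coeff_rescale] at h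
    have h2 := one_sub_pow_succ_ne_zero hp0 hp1 n
    refine (mul_eq_zero.1 (?_ : (1 - p ^ (n + 1)) * _ = 0)).resolve_left h2
    linarith

/-! ### The Hahn-Exton function at the points of the lattice -/

/-- `1 / (p; p)_k`, extended by `0` to negative `k`. -/
def invPoch (p : ℝ) (k : ℤ) : ℝ := if 0 ≤ k then 1 / qPoch p p k.toNat else 0

/-- For negative k the product contains the factor 1 - p^0, at index -k - 1. This is why `invPoch`
is extended by zero. -/
theorem qPochInf_zpow_succ {p : ℝ} (hp0 : 0 < p) (hp1 : p < 1) (k : ℤ) :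
    qPochInf (p ^ (k + 1)) p = qPochInf p p * invPoch p k := by
  rw [invPoch]
  split_ifs with h
  · lift k to ℕ using h
    have h1 := qPochInf_eq_mul hp0 hp1 p k
    have h2 := qPoch_self_ne_zero hp0 hp1 k
    rw [Int.toNat_natCast, h1]
    field_simp
    congr 1
    rw [← pow_succ' p k]
    exact_mod_cast rfl
  · rw [mul_zero, qPochInf]
    refine tprod_of_exists_eq_zero ⟨(-k - 1).toNat, ?_⟩
    have : (((-k - 1).toNat : ℕ) : ℤ) = -k - 1 := Int.toNat_of_nonneg (by omega)
    rw [← zpow_natCast, this, ← zpow_add₀ hp0.ne']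
    simp

theorem invPoch_nonneg {p : ℝ} (hp0 : 0 < p) (hp1 : p < 1) (k : ℤ) : 0 ≤ invPoch p k := by
  rw [invPoch]
  split_ifs
  · exact (one_div_pos.2 (qPoch_pos hp0 hp1 hp1 _)).le
  · rfl

theorem invPoch_le {p : ℝ} (hp0 : 0 < p) (hp1 : p < 1) (k : ℤ) :
    invPoch p k ≤ 1 / qPochInf p p := by
  have h := qPochInf_pos hp0 hp1 hp1
  rw [invPoch]
  split_ifs
  · exact one_div_le_one_div_of_le h (qPochInf_le_qPoch hp0 hp1 hp0.le hp1 _)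
  · exact (one_div_pos.2 h).le

/-- With c_n the Euler coefficients, expanding the infinite product by Euler turns both sides into
the double series of c_n c_m z^n w^m p^(nm), which is symmetric in (n, z) and (m, w). -/
theorem tsum_eulerCoeff_comm {p w : ℝ} (hp0 : 0 < p) (hp1 : p < 1) (z : ℝ) :
    ∑' n, eulerCoeff p n * z ^ n * qPochInf (w * p ^ n) p =
      ∑' m, eulerCoeff p m * w ^ m * qPochInf (z * p ^ m) p := by
  have hs : Summable fun x : ℕ × ℕ =>
      eulerCoeff p x.1 * z ^ x.1 * (eulerCoeff p x.2 * (w * p ^ x.1) ^ x.2) := by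
    refine Summable.of_norm_bounded ((summable_eulerCoeff_mul_pow hp0 hp1 z).mul_of_nonneg
      (summable_eulerCoeff_mul_pow hp0 hp1 w) (fun _ => norm_nonneg _) (fun _ => norm_nonneg _))
      fun x => ?_
    rw [norm_mul]
    refine mul_le_mul_of_nonneg_left ?_ (norm_nonneg _)
    rw [mul_pow, ← mul_assoc, norm_mul]
    refine mul_le_of_le_one_right (norm_nonneg _) ?_
    rw [norm_pow, norm_pow, Real.norm_eq_abs, abs_of_pos hp0, ← pow_mul]
    exact pow_le_one₀ hp0.le hp1.le
  have h := Summable.tsum_comm (f := fun n m =>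
    eulerCoeff p n * z ^ n * (eulerCoeff p m * (w * p ^ n) ^ m)) hs
  simp only [← tsum_eulerCoeff hp0 hp1, ← tsum_mul_left]
  rw [← h]
  refine tsum_congr fun m => tsum_congr fun n => ?_
  rw [mul_pow, mul_pow, ← pow_mul, ← pow_mul, mul_comm m n]
  ring

theorem hahnExton_term {p w : ℝ} (hp0 : 0 < p) (hp1 : p < 1) (hw : w < 1) (y : ℝ) (n : ℕ) :
    qPochInf w p * ((-1) ^ n * (p ^ (n * (n + 1) / 2) / (qPoch p p n * qPoch w p n)) * y ^ n) =
      eulerCoeff p n * (p * y) ^ n * qPochInf (w * p ^ n) p := by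
  have h3 : n * (n + 1) / 2 = n + n.choose 2 := by
    have : (n + 1).choose 2 = n + n.choose 2 := by simp [Nat.choose_succ_succ' n 1]
    rw [← this, Nat.choose_two_right, mul_comm, Nat.add_sub_cancel]
  have h1 := qPoch_self_ne_zero hp0 hp1 n
  have h2 := (qPoch_pos hp0 hp1 hw n).ne'
  rw [qPochInf_eq_mul hp0 hp1 w n, h3, eulerCoeff]
  field_simp
  ring

theorem hahnExton_eq_tsum {q v : ℝ} (hq0 : 0 < q) (hq1 : q < 1) (hv : -1 < v) (x : ℝ) :
    qPochInf ((q ^ 2) ^ (v + 1)) (q ^ 2) * hahnExton v x (q ^ 2) =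
      ∑' n, eulerCoeff (q ^ 2) n * (q ^ 2 * x ^ 2) ^ n *
        qPochInf ((q ^ 2) ^ (v + 1) * (q ^ 2) ^ n) (q ^ 2) := by
  have hp0 : 0 < q ^ 2 := by positivity
  have hp1 : q ^ 2 < 1 := by nlinarith
  have hw : (q ^ 2) ^ (v + 1) < 1 := Real.rpow_lt_one hp0.le hp1 (by linarith)
  rw [hahnExton, ← tsum_mul_left]
  refine tsum_congr fun n => ?_
  rw [pow_mul x 2 n]
  exact hahnExton_term hp0 hp1 hw (x ^ 2) n

/-- The symmetry moves the argument of the Bessel function from the powers into the infinite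
product, which becomes (p^(k+m+1); p)_∞ at the lattice points. -/
theorem hahnExton_zpow {q v : ℝ} (hq0 : 0 < q) (hq1 : q < 1) (hv : -1 < v) (k : ℤ) :
    qPochInf ((q ^ 2) ^ (v + 1)) (q ^ 2) / qPochInf (q ^ 2) (q ^ 2) *
        hahnExton v (q ^ k) (q ^ 2) =
      ∑' m : ℕ, eulerCoeff (q ^ 2) m * ((q ^ 2) ^ (v + 1)) ^ m * invPoch (q ^ 2) (k + m) := by
  have hp0 : 0 < q ^ 2 := by positivity
  have hp1 : q ^ 2 < 1 := by nlinarith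
  have hP := (qPochInf_pos hp0 hp1 hp1).ne'
  rw [div_mul_eq_mul_div, hahnExton_eq_tsum hq0 hq1 hv, tsum_eulerCoeff_comm hp0 hp1,
    div_eq_iff hP, ← tsum_mul_right]
  refine tsum_congr fun m => ?_
  have : q ^ 2 * (q ^ k) ^ 2 * (q ^ 2) ^ m = (q ^ 2) ^ (k + m + 1) := by
    rw [zpow_add₀ hp0.ne', zpow_add₀ hp0.ne', zpow_one, zpow_natCast]
    have : (q ^ k) ^ 2 = (q ^ 2) ^ k := by
      rw [← zpow_natCast, ← zpow_natCast, ← zpow_mul, ← zpow_mul, mul_comm]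
    rw [this]
    ring
  rw [this, qPochInf_zpow_succ hp0 hp1]
  ring

/-! ### Convolution of summable functions on `ℤ` -/

/-- Convolution on `ℤ`. -/
def conv (f g : ℤ → ℝ) (k : ℤ) : ℝ := ∑' i, f i * g (k - i)

theorem summable_conv_pair {f g : ℤ → ℝ} (hf : Summable f) (hg : Summable g) :
    Summable fun x : ℤ × ℤ => f x.1 * g (x.2 - x.1) := by
  have h := summable_mul_of_summable_norm hf.norm hg.norm
  let e : ℤ × ℤ ≃ ℤ × ℤ :=
    { toFun := fun x => (x.1, x.2 - x.1)
      invFun := fun x => (x.1, x.2 + x.1)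
      left_inv := fun x => by simp
      right_inv := fun x => by simp }
  exact e.summable_iff.2 h

theorem summable_conv {f g : ℤ → ℝ} (hf : Summable f) (hg : Summable g) :
    Summable (conv f g) :=
  Summable.prod (f := fun x : ℤ × ℤ => f x.2 * g (x.1 - x.2))
    ((Equiv.prodComm ℤ ℤ).summable_iff.2 (summable_conv_pair hf hg))

theorem conv_comm (f g : ℤ → ℝ) : conv f g = conv g f := by
  funext k
  rw [conv, conv, ← (Equiv.subLeft k).tsum_eq]
  refine tsum_congr fun i => ?_
  simp [mul_comm]

theorem conv_assoc {f g h : ℤ → ℝ} (hf : Summable f) (hg : Summable g) (hh : Summable h) :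
    conv (conv f g) h = conv f (conv g h) := by
  funext k
  have hs : Summable fun x : ℤ × ℤ => f x.1 * g (x.2 - x.1) * h (k - x.2) := by
    refine Summable.of_norm_bounded ((summable_conv_pair hf hg).norm.mul_right (∑' i, ‖h i‖))
      fun x => ?_
    rw [norm_mul]
    exact mul_le_mul_of_nonneg_left (hh.norm.le_tsum _ fun _ _ => norm_nonneg _) (norm_nonneg _)
  have hc := Summable.tsum_comm (f := fun i j => f i * g (j - i) * h (k - j)) hs
  simp only [conv, ← tsum_mul_right, ← tsum_mul_left]
  rw [hc]
  refine tsum_congr fun i => ?_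
  rw [← (Equiv.addRight i).tsum_eq]
  refine tsum_congr fun j => ?_
  simp only [Equiv.coe_addRight, add_sub_cancel_right]
  rw [mul_assoc, sub_sub, add_comm j i]

theorem conv_neg (f g : ℤ → ℝ) (k : ℤ) :
    conv f g (-k) = conv (fun i => f (-i)) (fun i => g (-i)) k := by
  rw [conv, conv, ← (Equiv.neg ℤ).tsum_eq]
  refine tsum_congr fun i => ?_
  simp only [Equiv.neg_apply]
  congr 2
  ring

theorem summable_comp_neg {f : ℤ → ℝ} (hf : Summable f) : Summable fun i => f (-i) :=
  (Equiv.neg ℤ).summable_iff.2 hf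

/-- The unit of convolution. -/
def convUnit (k : ℤ) : ℝ := if k = 0 then 1 else 0

theorem convUnit_conv (f : ℤ → ℝ) : conv convUnit f = f := by
  funext k
  rw [conv, tsum_eq_single 0 fun i hi => by simp [convUnit, hi]]
  simp [convUnit]

/-! ### The kernel of the Hankel transform -/

/-- The Laurent coefficients of `(r / s; p)_∞ / (r s; p)_∞`. -/
def kernel (p r : ℝ) (k : ℤ) : ℝ :=
  ∑' m : ℕ, eulerCoeff p m * r ^ m * (invPoch p (k + m) * r ^ (k + m))

/-- The coefficients of `(r s; p)_∞`. -/
def eulerZ (p r : ℝ) (k : ℤ) : ℝ := if 0 ≤ k then eulerCoeff p k.toNat * r ^ k.toNat else 0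

theorem eulerZ_natCast (p r : ℝ) (m : ℕ) : eulerZ p r m = eulerCoeff p m * r ^ m := by
  simp [eulerZ]

theorem support_eulerZ_mul (p r : ℝ) (g : ℤ → ℝ) :
    (Function.support fun i => eulerZ p r i * g i) ⊆ Set.range ((↑) : ℕ → ℤ) := by
  intro i hi
  rcases lt_or_ge i 0 with h | h
  · simp [eulerZ, not_le.2 h] at hi
  · exact ⟨i.toNat, Int.toNat_of_nonneg h⟩

theorem tsum_eulerZ_mul (p r : ℝ) (g : ℤ → ℝ) :
    ∑' i, eulerZ p r i * g i = ∑' m : ℕ, eulerCoeff p m * r ^ m * g m := by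
  rw [← Nat.cast_injective.tsum_eq (support_eulerZ_mul p r g)]
  simp only [eulerZ_natCast]

theorem summable_eulerZ {p : ℝ} (hp0 : 0 < p) (hp1 : p < 1) (r : ℝ) : Summable (eulerZ p r) := by
  refine (Function.Injective.summable_iff (Nat.cast_injective (R := ℤ)) fun i hi => ?_).1 ?_
  · by_contra h
    exact hi (support_eulerZ_mul p r 1 (by simpa using h))
  · simpa [Function.comp_def, eulerZ_natCast] using (summable_eulerCoeff_mul_pow hp0 hp1 r).of_norm

/-- The coefficients of `1 / (r s; p)_∞`. -/
def invPochZ (p r : ℝ) (k : ℤ) : ℝ := invPoch p k * r ^ k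

theorem invPoch_of_neg (p : ℝ) {k : ℤ} (hk : k < 0) : invPoch p k = 0 := by
  simp [invPoch, not_le.2 hk]

theorem summable_invPochZ {p r : ℝ} (hp0 : 0 < p) (hp1 : p < 1) (hr0 : 0 < r) (hr1 : r < 1) :
    Summable (invPochZ p r) := by
  refine (Function.Injective.summable_iff (Nat.cast_injective (R := ℤ)) fun i hi => ?_).1 ?_
  · rcases lt_or_ge i 0 with h | h
    · simp [invPochZ, invPoch_of_neg p h]
    · exact absurd ⟨i.toNat, Int.toNat_of_nonneg h⟩ hi
  · refine Summable.of_nonneg_of_le (fun m => ?_) (fun m => ?_)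
      ((summable_geometric_of_lt_one hr0.le hr1).mul_left (1 / qPochInf p p))
    · exact mul_nonneg (invPoch_nonneg hp0 hp1 _) (zpow_nonneg hr0.le _)
    · simp only [Function.comp_apply, invPochZ, zpow_natCast]
      exact mul_le_mul_of_nonneg_right (invPoch_le hp0 hp1 _) (pow_nonneg hr0.le _)

/-- The factor r^k comes out of the convolution, leaving the finite sums that express A B = 1 for
power series. -/
theorem eulerZ_conv_invPochZ {p r : ℝ} (hp0 : 0 < p) (hp1 : p < 1) :
    conv (eulerZ p r) (invPochZ p r) = convUnit := by
  funext k
  rw [conv, tsum_eulerZ_mul p r fun i => invPochZ p r (k - i)]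
  rcases lt_or_ge k 0 with h | h
  · rw [convUnit, if_neg h.ne]
    refine (tsum_congr fun m => ?_).trans tsum_zero
    rw [invPochZ, invPoch_of_neg p (by omega)]
    simp
  · lift k to ℕ using h with n
    rw [tsum_eq_sum (s := Finset.range (n + 1)) fun m hm => by
      rw [Finset.mem_range] at hm
      rw [invPochZ, invPoch_of_neg p (by omega)]
      simp]
    have h1 := Finset.Nat.sum_antidiagonal_eq_sum_range_succ
      (fun i j => eulerCoeff p i * (1 / qPoch p p j)) n
    rw [sum_antidiagonal_eulerCoeff hp0 hp1] at h1
    have h2 : ∑ m ∈ Finset.range (n + 1), eulerCoeff p m * r ^ m * invPochZ p r (n - m) =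
        r ^ n * ∑ m ∈ Finset.range (n + 1), eulerCoeff p m * (1 / qPoch p p (n - m)) := by
      rw [Finset.mul_sum]
      refine Finset.sum_congr rfl fun m hm => ?_
      have hm' : m ≤ n := by rw [Finset.mem_range] at hm; omega
      have : r ^ n = r ^ m * r ^ (n - m) := by rw [← pow_add]; congr 1; omega
      rw [← Nat.cast_sub hm', invPochZ, invPoch, if_pos (by positivity), Int.toNat_natCast,
        zpow_natCast, this]
      ring
    rw [h2, ← h1, convUnit]
    rcases n with _ | n <;> simp
    omega

theorem kernel_eq_conv (p r : ℝ) :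
    kernel p r = conv (fun i => eulerZ p r (-i)) (invPochZ p r) := by
  funext k
  rw [conv, ← (Equiv.neg ℤ).tsum_eq]
  simp only [Equiv.neg_apply, neg_neg, sub_neg_eq_add]
  rw [tsum_eulerZ_mul p r fun i => invPochZ p r (k + i)]
  rfl

theorem summable_kernel {p r : ℝ} (hp0 : 0 < p) (hp1 : p < 1) (hr0 : 0 < r) (hr1 : r < 1) :
    Summable (kernel p r) := by
  rw [kernel_eq_conv]
  exact summable_conv (summable_comp_neg (summable_eulerZ hp0 hp1 r))
    (summable_invPochZ hp0 hp1 hr0 hr1)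

/-- If `b` is the convolution inverse of `a`, then the convolution of `a` with the reflection of `b`
has orthonormal translates. -/
theorem tsum_translates_of_conv_eq_unit {a b : ℤ → ℝ} (sa : Summable a) (sb : Summable b)
    (hba : conv b a = convUnit) (i j : ℤ) :
    ∑' k, conv (fun i => b (-i)) a (k + i) * conv (fun i => b (-i)) a (k + j) =
      if i = j then 1 else 0 := by
  have sb' := summable_comp_neg sb
  have sa' := summable_comp_neg sa
  have hab' : conv (fun i => a (-i)) (fun i => b (-i)) = convUnit := by
    rw [conv_comm]
    funext k
    rw [← conv_neg, hba]
    simp [convUnit]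
  have hk' : (fun i => conv (fun i => b (-i)) a (-i)) = conv b (fun i => a (-i)) := by
    funext i
    rw [conv_neg]
    simp only [neg_neg]
  -- Writing ~ for reflection and h = b~ * a, this is h~ * h = (b * a~) * (b~ * a) = b * (a~ * b~) *
  -- a = b * a. Summability justifies the regrouping.
  have key : conv (fun i => conv (fun i => b (-i)) a (-i)) (conv (fun i => b (-i)) a) =
      convUnit := by
    rw [hk', conv_assoc sb sa' (summable_conv sb' sa), ← conv_assoc sa' sb' sa, hab',
      convUnit_conv, hba]
  generalize conv (fun i => b (-i)) a = h at key
  have h' := congrFun key (j - i)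
  -- The substitution k ↦ -i - k turns the convolution at j - i into the sum of products of
  -- translates.
  rw [conv, ← (Equiv.subLeft (-i)).tsum_eq] at h'
  rw [show (if i = j then (1 : ℝ) else 0) = convUnit (j - i) by
    simp [convUnit, sub_eq_zero, eq_comm], ← h']
  refine tsum_congr fun k => ?_
  simp only [Equiv.subLeft_apply]
  congr 2 <;> ring

/-- The orthogonality relation for the Hahn-Exton function. -/
theorem tsum_kernel_mul_kernel {p r : ℝ} (hp0 : 0 < p) (hp1 : p < 1) (hr0 : 0 < r) (hr1 : r < 1)
    (i j : ℤ) : ∑' k, kernel p r (k + i) * kernel p r (k + j) = if i = j then 1 else 0 := by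
  rw [kernel_eq_conv]
  exact tsum_translates_of_conv_eq_unit (summable_invPochZ hp0 hp1 hr0 hr1)
    (summable_eulerZ hp0 hp1 r) (eulerZ_conv_invPochZ hp0 hp1) i j

theorem kernel_eq_zpow_mul {p r : ℝ} (hr0 : 0 < r) (k : ℤ) :
    kernel p r k = r ^ k * ∑' m : ℕ, eulerCoeff p m * (r ^ 2) ^ m * invPoch p (k + m) := by
  rw [kernel, ← tsum_mul_left]
  refine tsum_congr fun m => ?_
  rw [zpow_add₀ hr0.ne', zpow_natCast]
  ring

/-- Once r^k is pulled out, the remaining series is bounded uniformly in k, because `invPoch` is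
bounded. -/
theorem exists_abs_kernel_le {p r : ℝ} (hp0 : 0 < p) (hp1 : p < 1) (hr0 : 0 < r) :
    ∃ C, 0 ≤ C ∧ ∀ k, |kernel p r k| ≤ C * r ^ k := by
  have hs := (summable_eulerCoeff_mul_pow hp0 hp1 (r ^ 2)).mul_right (1 / qPochInf p p)
  have hb : ∀ (k : ℤ) (m : ℕ), ‖eulerCoeff p m * (r ^ 2) ^ m * invPoch p (k + m)‖ ≤
      ‖eulerCoeff p m * (r ^ 2) ^ m‖ * (1 / qPochInf p p) := by
    intro k m
    rw [norm_mul, Real.norm_eq_abs (invPoch p (k + m)), abs_of_nonneg (invPoch_nonneg hp0 hp1 _)]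
    exact mul_le_mul_of_nonneg_left (invPoch_le hp0 hp1 _) (norm_nonneg _)
  refine ⟨∑' m : ℕ, ‖eulerCoeff p m * (r ^ 2) ^ m‖ * (1 / qPochInf p p), tsum_nonneg fun m =>
    (norm_nonneg _).trans (hb 0 m), fun k => ?_⟩
  rw [kernel_eq_zpow_mul hr0, abs_mul, abs_of_pos (zpow_pos hr0 k), mul_comm]
  exact mul_le_mul_of_nonneg_right (tsum_of_norm_bounded hs.hasSum (hb k)) (zpow_pos hr0 k).le

/-! ### Compact symmetric operators -/

section Spectral

variable {E : Type*} [NormedAddCommGroup E] [InnerProductSpace ℝ E]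

/-- The spectral radius of a self-adjoint operator is its norm and is attained on the spectrum; a
nonzero spectral value of a compact operator is an eigenvalue. -/
theorem exists_hasEigenvalue_abs_eq_norm [CompleteSpace E] {T : E →L[ℝ] E} (hT : IsCompactOperator T)
    (hT' : T.IsSymmetric) (hT0 : T ≠ 0) :
    ∃ (x : E) (μ : ℝ), x ≠ 0 ∧ T x = μ • x ∧ |μ| = ‖T‖ := by
  have hrad := T.spectralRadius_eq_nnnorm hT'.isSelfAdjoint
  -- Over ℝ the spectrum could a priori be empty, but then the spectral radius, an empty supremum,
  -- would be 0 = ‖T‖.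
  have hne : (spectrum ℝ T).Nonempty := by
    by_contra h
    rw [Set.not_nonempty_iff_eq_empty] at h
    rw [spectralRadius, h] at hrad
    simp only [Set.mem_empty_iff_false, iSup_false, iSup_bot] at hrad
    exact hT0 (nnnorm_eq_zero.1 (by simpa using hrad.symm))
  obtain ⟨μ, hμ, hμr⟩ := spectrum.exists_nnnorm_eq_spectralRadius_of_nonempty hne
  rw [hrad] at hμr
  have hμn : ‖μ‖ = ‖T‖ := by
    have : ‖μ‖₊ = ‖T‖₊ := by exact_mod_cast hμr
    exact congrArg NNReal.toReal this
  have hμ0 : μ ≠ 0 := by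
    rw [← norm_ne_zero_iff, hμn]
    exact norm_ne_zero_iff.2 hT0
  obtain ⟨y, hy⟩ := ((hT.hasEigenvalue_iff_mem_spectrum hμ0).2 hμ).exists_hasEigenvector
  exact ⟨y, μ, hy.2, hy.apply_eq_smul, hμn⟩

theorem exists_eigenvector_norm_le [CompleteSpace E] {T : E →L[ℝ] E} (hT : IsCompactOperator T)
    (hT' : T.IsSymmetric) (hinj : ∀ x, T x = 0 → x = 0) {V : Submodule ℝ E}
    (hVc : IsClosed (V : Set E)) (hV : V ≠ ⊥) (hTV : ∀ x ∈ V, T x ∈ V) :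
    ∃ (x : E) (μ : ℝ), x ∈ V ∧ ‖x‖ = 1 ∧ T x = μ • x ∧ ∀ y ∈ V, ‖T y‖ ≤ |μ| * ‖y‖ := by
  have : CompleteSpace V := hVc.completeSpace_coe
  obtain ⟨x₀, hx₀V, hx₀⟩ := (Submodule.ne_bot_iff V).1 hV
  obtain ⟨S, hS, hSc, hSs⟩ : ∃ S : V →L[ℝ] V, (∀ x : V, ((S x : V) : E) = T x) ∧
      IsCompactOperator S ∧ S.IsSymmetric :=
    ⟨T.restrict hTV, fun _ => rfl, hT.restrict' hTV, hT'.restrict_invariant hTV⟩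
  have hS0 : S ≠ 0 := by
    rintro rfl
    exact hx₀ (hinj _ (hS ⟨x₀, hx₀V⟩).symm)
  obtain ⟨y, μ, hy, hyμ, hμ⟩ := exists_hasEigenvalue_abs_eq_norm hSc hSs hS0
  have hy0 : (y : E) ≠ 0 := fun h => hy (Subtype.ext h)
  have hTy : T y = μ • (y : E) := by
    rw [← hS, hyμ, Submodule.coe_smul]
  refine ⟨‖(y : E)‖⁻¹ • (y : E), μ, V.smul_mem _ y.2, ?_, ?_, ?_⟩
  · rw [norm_smul, norm_inv, norm_norm, inv_mul_cancel₀ (norm_ne_zero_iff.2 hy0)]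
  · rw [map_smul, hTy, smul_comm]
  · intro z hz
    rw [hμ, ← hS ⟨z, hz⟩]
    exact S.le_opNorm ⟨z, hz⟩

theorem orthogonal_invariant {T : E →L[ℝ] E} (hT' : T.IsSymmetric) {S : Submodule ℝ E}
    (hS : ∀ x ∈ S, T x ∈ S) : ∀ x ∈ Sᗮ, T x ∈ Sᗮ := by
  intro x hx
  rw [Submodule.mem_orthogonal] at hx ⊢
  intro u hu
  have : inner ℝ (T u) x = inner ℝ u (T x) := hT' u x
  rw [← this]
  exact hx _ (hS u hu)

theorem span_range_invariant {ι : Type*} {T : E →L[ℝ] E} {e : ι → E} {l : ι → ℝ}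
    (he : ∀ i, T (e i) = l i • e i) :
    ∀ x ∈ Submodule.span ℝ (Set.range e), T x ∈ Submodule.span ℝ (Set.range e) := by
  intro x hx
  have : Submodule.span ℝ (Set.range e) ≤
      (Submodule.span ℝ (Set.range e)).comap (T : E →ₗ[ℝ] E) := by
    rw [Submodule.span_le]
    rintro _ ⟨i, rfl⟩
    simp only [Submodule.comap_coe, Set.mem_preimage, ContinuousLinearMap.coe_coe,
      SetLike.mem_coe, he]
    exact Submodule.smul_mem _ _ (Submodule.subset_span ⟨i, rfl⟩)
  exact this hx

theorem mem_orthogonal_span_range {ι : Type*} {e : ι → E} {y : E}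
    (hy : ∀ i, inner ℝ y (e i) = 0) : y ∈ (Submodule.span ℝ (Set.range e))ᗮ := by
  rw [Submodule.mem_orthogonal']
  intro u hu
  induction hu using Submodule.span_induction with
  | mem u hu => obtain ⟨i, rfl⟩ := hu; exact hy i
  | zero => simp
  | add u w _ _ h1 h2 => rw [inner_add_right, h1, h2, add_zero]
  | smul c u _ h => rw [inner_smul_right, h, mul_zero]

/-- A compact operator has no orthonormal sequence of eigenvectors with eigenvalues bounded away
from zero. -/
theorem not_le_abs_eigenvalues {T : E →L[ℝ] E} (hT : IsCompactOperator T) {e : ℕ → E}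
    {l : ℕ → ℝ} (he : Orthonormal ℝ e) (hl : ∀ i, T (e i) = l i • e i) {c : ℝ} (hc : 0 < c) :
    ¬ ∀ i, c ≤ |l i| := by
  intro h
  obtain ⟨K, hK, hKT⟩ := IsCompactOperator.image_closedBall_subset_compact (f := (T : E →ₗ[ℝ] E)) hT 1
  have hmem : ∀ n, T (e n) ∈ K := fun n =>
    hKT ⟨e n, by simp [he.1 n], rfl⟩
  obtain ⟨a, -, φ, hφ, ha⟩ := hK.tendsto_subseq hmem
  obtain ⟨n, hn⟩ := Metric.cauchySeq_iff'.1 ha.cauchySeq c hc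
  have h1 := hn (n + 1) (Nat.le_succ n)
  have hne : φ (n + 1) ≠ φ n := (hφ (Nat.lt_succ_self n)).ne'
  simp only [Function.comp_apply, dist_eq_norm, hl] at h1
  -- The images of distinct e_i are orthogonal, so their distance is at least c; no subsequence of T
  -- e_i is Cauchy.
  have h2 : ‖l (φ (n + 1)) • e (φ (n + 1)) - l (φ n) • e (φ n)‖ ^ 2 =
      l (φ (n + 1)) ^ 2 + l (φ n) ^ 2 := by
    rw [norm_sub_sq_real, inner_smul_left, inner_smul_right, he.2 hne, norm_smul, norm_smul,
      he.1, he.1]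
    simp
  have h3 : c ^ 2 ≤ l (φ n) ^ 2 := by
    rw [← sq_abs (l _)]
    exact pow_le_pow_left₀ hc.le (h _) 2
  have h4 : ‖l (φ (n + 1)) • e (φ (n + 1)) - l (φ n) • e (φ n)‖ ^ 2 < c ^ 2 :=
    pow_lt_pow_left₀ h1 (norm_nonneg _) two_ne_zero
  nlinarith [sq_nonneg (l (φ (n + 1)))]

/-- The spectral theorem for an injective compact symmetric operator, with the eigenvectors listed
by decreasing absolute values of the eigenvalues. -/
theorem exists_sorted_eigenvectors [CompleteSpace E] {T : E →L[ℝ] E} (hT : IsCompactOperator T)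
    (hT' : T.IsSymmetric) (hinj : ∀ x, T x = 0 → x = 0) (hinf : ¬ FiniteDimensional ℝ E) :
    ∃ (e : ℕ → E) (l : ℕ → ℝ), Orthonormal ℝ e ∧ (∀ i, T (e i) = l i • e i) ∧
      (∀ i j, i ≤ j → |l j| ≤ |l i|) ∧ ∀ x, (∀ i, inner ℝ x (e i) = 0) → x = 0 := by
  -- The next eigenvector is one of largest |eigenvalue| on the complement of those already found.
  -- The choice is made total, with the junk value (0, 0), so that it can be iterated before the
  -- finite-dimensionality and invariance of the subspaces are known.
  have step : ∀ S : Submodule ℝ E, ∃ xμ : E × ℝ, (FiniteDimensional ℝ S ∧ ∀ x ∈ S, T x ∈ S) →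
      xμ.1 ∈ Sᗮ ∧ ‖xμ.1‖ = 1 ∧ T xμ.1 = xμ.2 • xμ.1 ∧ ∀ y ∈ Sᗮ, ‖T y‖ ≤ |xμ.2| * ‖y‖ := by
    intro S
    by_cases h : FiniteDimensional ℝ S ∧ ∀ x ∈ S, T x ∈ S
    · have := h.1
      have hbot : Sᗮ ≠ ⊥ := by
        intro hb
        rw [Submodule.orthogonal_eq_bot_iff] at hb
        have h1 := h.1
        rw [hb] at h1
        exact hinf (Module.finite_def.2 (Module.Finite.iff_fg.1 h1))
      obtain ⟨x, μ, hx⟩ := exists_eigenvector_norm_le hT hT' hinj S.isClosed_orthogonal hbot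
        (orthogonal_invariant hT' h.2)
      exact ⟨(x, μ), fun _ => hx⟩
    · exact ⟨(0, 0), fun h' => absurd h' h⟩
  choose next hnext using step
  obtain ⟨S, hS0, hSs⟩ : ∃ S : ℕ → Submodule ℝ E, S 0 = ⊥ ∧
      ∀ n, S (n + 1) = S n ⊔ Submodule.span ℝ {(next (S n)).1} :=
    ⟨fun n => Nat.rec ⊥ (fun _ S => S ⊔ Submodule.span ℝ {(next S).1}) n, rfl, fun _ => rfl⟩
  have hgood : ∀ n : ℕ, FiniteDimensional ℝ (S n) ∧ ∀ x ∈ S n, T x ∈ S n := by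
    intro n
    induction n with
    | zero =>
      rw [hS0]
      refine ⟨inferInstance, fun x hx => ?_⟩
      rw [Submodule.mem_bot] at hx ⊢
      rw [hx, map_zero]
    | succ n ih =>
      have := ih.1
      rw [hSs]
      refine ⟨inferInstance, fun x hx => ?_⟩
      obtain ⟨y, hy, z, hz, rfl⟩ := Submodule.mem_sup.1 hx
      obtain ⟨c, rfl⟩ := Submodule.mem_span_singleton.1 hz
      rw [map_add, map_smul, (hnext _ ih).2.2.1]
      refine Submodule.add_mem_sup (ih.2 y hy) ?_
      exact Submodule.smul_mem _ _ (Submodule.smul_mem _ _ (Submodule.mem_span_singleton_self _))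
  have hmono : Monotone S := monotone_nat_of_le_succ fun n => by rw [hSs]; exact le_sup_left
  let e : ℕ → E := fun n => (next (S n)).1
  let l : ℕ → ℝ := fun n => (next (S n)).2
  have hmem : ∀ {i n}, i < n → e i ∈ S n := fun {i n} h => hmono (Nat.succ_le_of_lt h) (by
    rw [hSs]
    exact Submodule.mem_sup_right (Submodule.mem_span_singleton_self _))
  have hperp : ∀ n, e n ∈ (S n)ᗮ := fun n => (hnext _ (hgood n)).1
  have hnorm : ∀ n, ‖e n‖ = 1 := fun n => (hnext _ (hgood n)).2.1
  have heig : ∀ n, T (e n) = l n • e n := fun n => (hnext _ (hgood n)).2.2.1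
  have hmax : ∀ n, ∀ y ∈ (S n)ᗮ, ‖T y‖ ≤ |l n| * ‖y‖ := fun n => (hnext _ (hgood n)).2.2.2
  have hon : Orthonormal ℝ e := by
    refine ⟨hnorm, fun i j hij => ?_⟩
    rcases lt_or_gt_of_ne hij with h | h
    · exact (Submodule.mem_orthogonal _ _).1 (hperp j) _ (hmem h)
    · exact (Submodule.mem_orthogonal' _ _).1 (hperp i) _ (hmem h)
  refine ⟨e, l, hon, heig, fun i j hij => ?_, ?_⟩
  · have h := hmax i (e j) (Submodule.orthogonal_le (hmono hij) (hperp j))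
    rwa [heig, norm_smul, hnorm, mul_one, mul_one, Real.norm_eq_abs] at h
  · by_contra! hcon
    obtain ⟨x, hx, hx0⟩ := hcon
    set W := Submodule.span ℝ (Set.range e)
    -- If the e_i are not complete, their complement contains an eigenvector y with eigenvalue μ ≠
    -- 0. It competes at every stage, so |μ| ≤ |l n| for all n, contradicting compactness.
    obtain ⟨y, μ, hy, hy1, hyμ, -⟩ := exists_eigenvector_norm_le hT hT' hinj
      W.isClosed_orthogonal ((Submodule.ne_bot_iff _).2 ⟨x, mem_orthogonal_span_range hx, hx0⟩)
      (orthogonal_invariant hT' (span_range_invariant heig))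
    have hμ : μ ≠ 0 := by
      rintro rfl
      rw [zero_smul] at hyμ
      rw [hinj y hyμ, norm_zero] at hy1
      exact zero_ne_one hy1
    have hSW : ∀ n, S n ≤ W := by
      intro n
      induction n with
      | zero => rw [hS0]; exact bot_le
      | succ n ih =>
        rw [hSs]
        refine sup_le ih ?_
        rw [Submodule.span_singleton_le_iff_mem]
        exact Submodule.subset_span ⟨n, rfl⟩
    refine not_le_abs_eigenvalues hT hon heig (abs_pos.2 hμ) fun n => ?_
    have h := hmax n y (Submodule.orthogonal_le (hSW n) hy)
    rwa [hyμ, norm_smul, hy1, mul_one, mul_one, Real.norm_eq_abs] at h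

end Spectral

/-! ### Zeros of power series accumulating at the origin -/

theorem eq_zero_of_tsum_mul_pow_eq_zero {d : ℕ → ℝ} (hd : ∀ y : ℝ, Summable fun l => d l * y ^ l)
    {y : ℕ → ℝ} (hy : Tendsto y atTop (𝓝 0)) (hy0 : ∀ k, y k ≠ 0)
    (hz : ∀ k, ∑' l, d l * y k ^ l = 0) (l : ℕ) : d l = 0 := by
  have hf : HasFPowerSeriesAt (fun y : ℝ => ∑' l, d l * y ^ l)
      (FormalMultilinearSeries.ofScalars ℝ d) 0 := by
    rw [hasFPowerSeriesAt_iff]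
    refine Eventually.of_forall fun z => ?_
    simpa [FormalMultilinearSeries.coeff_ofScalars, mul_comm] using (hd z).hasSum
  have hfreq : ∃ᶠ z in 𝓝[≠] (0 : ℝ), (fun y : ℝ => ∑' l, d l * y ^ l) z = 0 :=
    (tendsto_nhdsWithin_iff.2 ⟨hy, Eventually.of_forall hy0⟩).frequently
      (Frequently.of_forall hz)
  have hev := hf.analyticAt.frequently_zero_iff_eventually_zero.1 hfreq
  have h0 := hf.eq_zero_of_eventually hev
  have h1 : (FormalMultilinearSeries.ofScalars ℝ d).coeff l = 0 := by
    rw [h0]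
    rfl
  rwa [FormalMultilinearSeries.coeff_ofScalars] at h1

/-! ### The Taylor coefficients of the kernel -/

/-- The coefficients of `r ^ (-k) * kernel p r k` as a power series in `p ^ k`. -/
def kernelCoeff (p r : ℝ) (l : ℕ) : ℝ :=
  eulerCoeff p l * p ^ l * qPochInf (r ^ 2 * p ^ l) p / qPochInf p p

/-- This is again `tsum_eulerCoeff_comm`, now read so that p^k appears in the powers and not in the
infinite product. -/
theorem kernel_eq_tsum_kernelCoeff {p r : ℝ} (hp0 : 0 < p) (hp1 : p < 1) (hr0 : 0 < r) (k : ℤ) :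
    kernel p r k = r ^ k * ∑' l, kernelCoeff p r l * (p ^ k) ^ l := by
  have hP := (qPochInf_pos hp0 hp1 hp1).ne'
  rw [kernel_eq_zpow_mul hr0]
  congr 1
  have h := tsum_eulerCoeff_comm (w := r ^ 2) hp0 hp1 (p ^ (k + 1))
  have h1 : ∀ m : ℕ, eulerCoeff p m * (r ^ 2) ^ m * qPochInf (p ^ (k + 1) * p ^ m) p =
      qPochInf p p * (eulerCoeff p m * (r ^ 2) ^ m * invPoch p (k + m)) := by
    intro m
    rw [← zpow_natCast p m, ← zpow_add₀ hp0.ne', show k + 1 + (m : ℤ) = k + m + 1 by ring,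
      qPochInf_zpow_succ hp0 hp1]
    ring
  have h2 : ∀ l : ℕ, eulerCoeff p l * (p ^ (k + 1)) ^ l * qPochInf (r ^ 2 * p ^ l) p =
      qPochInf p p * (kernelCoeff p r l * (p ^ k) ^ l) := by
    intro l
    rw [zpow_add_one₀ hp0.ne', kernelCoeff]
    field_simp
    ring
  rw [tsum_congr h1, tsum_congr h2, tsum_mul_left, tsum_mul_left] at h
  exact (mul_left_cancel₀ hP h).symm

theorem summable_kernelCoeff {p r : ℝ} (hp0 : 0 < p) (hp1 : p < 1) (hr0 : 0 < r) (hr1 : r < 1)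
    (y : ℝ) : Summable fun l => ‖kernelCoeff p r l * y ^ l‖ := by
  have hP := qPochInf_pos hp0 hp1 hp1
  refine Summable.of_nonneg_of_le (fun _ => norm_nonneg _) (fun l => ?_)
    ((summable_eulerCoeff_mul_pow hp0 hp1 (p * y)).mul_right (1 / qPochInf p p))
  have h1 : p ^ l ≤ 1 := pow_le_one₀ hp0.le hp1.le
  have h2 : 0 < p ^ l := pow_pos hp0 l
  have h3 : r ^ 2 < 1 := by nlinarith
  have h4 : r ^ 2 * p ^ l < 1 := by nlinarith [sq_nonneg r]
  have h5 := qPochInf_pos hp0 hp1 h4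
  have h6 : qPochInf (r ^ 2 * p ^ l) p ≤ 1 := by
    simpa [qPoch] using qPochInf_le_qPoch hp0 hp1 (by positivity) h4 0
  have h7 : kernelCoeff p r l * y ^ l =
      (eulerCoeff p l * (p * y) ^ l) * (1 / qPochInf p p) * qPochInf (r ^ 2 * p ^ l) p := by
    rw [kernelCoeff, mul_pow]
    ring
  rw [h7, norm_mul, norm_mul _ (1 / qPochInf p p), Real.norm_eq_abs (qPochInf _ _),
    abs_of_pos h5, Real.norm_eq_abs (1 / _), abs_of_pos (one_div_pos.2 hP)]
  exact mul_le_of_le_one_right (by positivity) h6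

/-! ### The Hankel transform on `ℓ²` -/

theorem memℓp_two_of_summable_sq {ι : Type*} {f : ι → ℝ} (hf : Summable fun i => f i ^ 2) :
    Memℓp f 2 := by
  refine memℓp_gen ?_
  simpa using hf

theorem summable_sq_of_memℓp_two {ι : Type*} {f : ι → ℝ} (hf : Memℓp f 2) :
    Summable fun i => f i ^ 2 := by
  simpa using hf.summable (by norm_num)

theorem summable_sq_of_summable {ι : Type*} {f : ι → ℝ} (hf : Summable f) :
    Summable fun i => f i ^ 2 := by
  refine Summable.of_nonneg_of_le (fun _ => sq_nonneg _) (fun i => ?_)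
    (hf.norm.mul_right (∑' i, ‖f i‖))
  rw [← sq_abs, sq, ← Real.norm_eq_abs]
  exact mul_le_mul_of_nonneg_left (hf.norm.le_tsum _ fun _ _ => norm_nonneg _) (norm_nonneg _)

theorem inner_lp_eq_tsum {ι : Type*} (f g : lp (fun _ : ι => ℝ) 2) :
    inner ℝ f g = ∑' i, f i * g i := by
  rw [lp.inner_eq_tsum]
  refine tsum_congr fun i => ?_
  simp [mul_comm]

theorem hasSum_lp_apply {ι κ : Type*} {f : κ → lp (fun _ : ι => ℝ) 2}
    {a : lp (fun _ : ι => ℝ) 2} (h : HasSum f a) (i : ι) : HasSum (fun k => f k i) (a i) := by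
  classical
  have h1 := h.mapL (innerSL ℝ (lp.single 2 i (1 : ℝ) : lp (fun _ : ι => ℝ) 2))
  simpa [lp.inner_single_left] using h1

/-- The columns of the matrix are an orthonormal family in ℓ²(ℤ), so u ↦ ∑ u_n c_n is isometric;
applying coordinate functionals gives the entries. -/
theorem exists_hankel_isometry {p r : ℝ} (hp0 : 0 < p) (hp1 : p < 1) (hr0 : 0 < r) (hr1 : r < 1)
    (N : ℤ) : ∃ G : lp (fun _ : ℕ => ℝ) 2 →ₗᵢ[ℝ] lp (fun _ : ℤ => ℝ) 2,
      ∀ u k, HasSum (fun n : ℕ => u n * kernel p r (k + (N + n))) (G u k) := by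
  have hs := summable_kernel hp0 hp1 hr0 hr1
  let c : ℕ → lp (fun _ : ℤ => ℝ) 2 := fun n => ⟨fun k => kernel p r (k + (N + n)),
    memℓp_two_of_summable_sq (summable_sq_of_summable ((Equiv.addRight (N + n)).summable_iff.2 hs))⟩
  have hc : ∀ n k, c n k = kernel p r (k + (N + n)) := fun _ _ => rfl
  have hon : Orthonormal ℝ c := by
    rw [orthonormal_iff_ite]
    intro i j
    rw [inner_lp_eq_tsum]
    simp only [hc]
    rw [tsum_kernel_mul_kernel hp0 hp1 hr0 hr1]
    simp
  refine ⟨hon.orthogonalFamily.linearIsometry, fun u k => ?_⟩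
  simpa [hc] using hasSum_lp_apply (hon.orthogonalFamily.hasSum_linearIsometry u) k

/-- The operator is the sum of the rank-one operators u ↦ u_m c_m, with c_m the columns. Their norms
decay geometrically, so the series converges in norm and its sum is compact. -/
theorem exists_compact_of_column_bound {a : ℕ → ℕ → ℝ} (hsymm : ∀ i j, a i j = a j i)
    {D r : ℝ} (hr0 : 0 < r) (hr1 : r < 1) (ha : ∀ i j, |a i j| ≤ D * r ^ i * r ^ j) :
    ∃ T : lp (fun _ : ℕ => ℝ) 2 →L[ℝ] lp (fun _ : ℕ => ℝ) 2, IsCompactOperator T ∧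
      T.IsSymmetric ∧ ∀ u n, HasSum (fun m => u m * a n m) (T u n) := by
  have hD : 0 ≤ D := by simpa using (abs_nonneg _).trans (ha 0 0)
  have hsq : ∀ i m, a i m ^ 2 ≤ (D * r ^ m) ^ 2 * (r ^ 2) ^ i := fun i m => by
    rw [← sq_abs]
    refine (pow_le_pow_left₀ (abs_nonneg _) (ha i m) 2).trans_eq ?_
    ring
  have hg : Summable fun i : ℕ => (r ^ 2) ^ i :=
    summable_geometric_of_lt_one (by positivity) (by nlinarith)
  have hcs : ∀ m, Summable fun i => a i m ^ 2 := fun m =>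
    Summable.of_nonneg_of_le (fun _ => sq_nonneg _) (fun i => hsq i m) (hg.mul_left _)
  let c : ℕ → lp (fun _ : ℕ => ℝ) 2 := fun m => ⟨fun i => a i m, memℓp_two_of_summable_sq (hcs m)⟩
  have hc : ∀ m i, c m i = a i m := fun _ _ => rfl
  have hcn : ∀ m, ‖c m‖ ≤ D * Real.sqrt (∑' i : ℕ, (r ^ 2) ^ i) * r ^ m := by
    intro m
    refine le_of_sq_le_sq ?_ (by positivity)
    rw [← real_inner_self_eq_norm_sq, inner_lp_eq_tsum, mul_right_comm, mul_pow,
      Real.sq_sqrt (tsum_nonneg fun i => by positivity), ← tsum_mul_left]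
    refine Summable.tsum_le_tsum (fun i => ?_) ?_ (hg.mul_left _)
    · rw [hc, ← sq]
      exact hsq i m
    · simpa [hc, sq] using hcs m
  let R : ℕ → lp (fun _ : ℕ => ℝ) 2 →L[ℝ] lp (fun _ : ℕ => ℝ) 2 := fun m =>
    (innerSL ℝ (lp.single 2 m (1 : ℝ) : lp (fun _ : ℕ => ℝ) 2)).smulRight (c m)
  have hR : ∀ m u, R m u = u m • c m := fun m u => by
    simp [R, lp.inner_single_left]
  have hRn : ∀ m, ‖R m‖ ≤ D * Real.sqrt (∑' i : ℕ, (r ^ 2) ^ i) * r ^ m := fun m => by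
    refine (R m).opNorm_le_bound (by positivity) fun u => ?_
    rw [hR, norm_smul, mul_comm]
    exact mul_le_mul (hcn m) (lp.norm_apply_le_norm two_ne_zero u m) (norm_nonneg _)
      (by positivity)
  have hRs : Summable R := Summable.of_norm_bounded
    ((summable_geometric_of_lt_one hr0.le hr1).mul_left _) hRn
  have happ : ∀ u, HasSum (fun m => u m • c m) ((∑' m, R m) u) := fun u => by
    have := hRs.hasSum.mapL (ContinuousLinearMap.apply ℝ (lp (fun _ : ℕ => ℝ) 2) u)
    simpa [hR] using this
  have hent : ∀ u n, HasSum (fun m => u m * a n m) ((∑' m, R m) u n) := fun u n => by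
    simpa [hc] using hasSum_lp_apply (happ u) n
  refine ⟨∑' m, R m, ?_, ?_, hent⟩
  · refine isCompactOperator_of_tendsto hRs.hasSum (Eventually.of_forall fun s => ?_)
    change ∑ m ∈ s, R m ∈ compactOperator (RingHom.id ℝ) (lp (fun _ : ℕ => ℝ) 2)
      (lp (fun _ : ℕ => ℝ) 2)
    refine Submodule.sum_mem _ fun m _ => ?_
    have h1 : IsCompactOperator (ContinuousLinearMap.smulRight (1 : ℝ →L[ℝ] ℝ) (c m)) :=
      isCompactOperator_of_locallyCompactSpace_rng _
    exact h1.comp_clm (innerSL ℝ (lp.single 2 m (1 : ℝ) : lp (fun _ : ℕ => ℝ) 2))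
  · intro u w
    have h1 : HasSum (fun m => u m * inner ℝ (c m) w) (inner ℝ ((∑' m, R m) u) w) := by
      have := (happ u).mapL (innerSL ℝ w)
      simpa [inner_smul_right, real_inner_comm] using this
    have h2 : ∀ m, inner ℝ (c m) w = (∑' m, R m) w m := fun m => by
      rw [inner_lp_eq_tsum, ← (hent w m).tsum_eq]
      refine tsum_congr fun i => ?_
      rw [hc, hsymm, mul_comm]
    simp only [h2] at h1
    change inner ℝ ((∑' m, R m) u) w = inner ℝ u ((∑' m, R m) w)
    rw [← h1.tsum_eq, inner_lp_eq_tsum]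

/-- The transform of u at k is r^k F(p^k), where F is a power series converging everywhere. If it
vanishes at all p^(N+n), which tend to 0, then F = 0, so the transform vanishes on all of ℤ. -/
theorem eq_zero_of_hankel_eq_zero {p r : ℝ} (hp0 : 0 < p) (hp1 : p < 1) (hr0 : 0 < r)
    (hr1 : r < 1) (N : ℤ) (u : lp (fun _ : ℕ => ℝ) 2)
    (hu : ∀ n : ℕ, ∑' m : ℕ, u m * kernel p r (N + n + (N + m)) = 0) (k : ℤ) :
    ∑' m : ℕ, u m * kernel p r (k + (N + m)) = 0 := by
  set t : ℕ → ℕ → ℝ := fun l m => u m * r ^ (N + m) * (kernelCoeff p r l * (p ^ (N + m)) ^ l)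
  have hpair : ∀ y : ℝ, Summable fun x : ℕ × ℕ => t x.1 x.2 * y ^ x.1 := by
    intro y
    refine Summable.of_norm_bounded (Summable.mul_of_nonneg
      (summable_kernelCoeff hp0 hp1 hr0 hr1 (p ^ N * y))
      ((summable_geometric_of_lt_one hr0.le hr1).mul_left (‖u‖ * r ^ N))
      (fun _ => norm_nonneg _) (fun _ => by positivity)) fun x => ?_
    -- Isolating the factor p^(lm), which is at most 1, leaves a product of a summable sequence in l
    -- and one in m.
    have e : t x.1 x.2 * y ^ x.1 =
        (kernelCoeff p r x.1 * (p ^ N * y) ^ x.1) * (p ^ x.2) ^ x.1 * (u x.2 * (r ^ N * r ^ x.2)) := by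
      simp only [t]
      rw [zpow_add₀ hr0.ne', zpow_add₀ hp0.ne', zpow_natCast, zpow_natCast]
      ring
    rw [e, norm_mul, norm_mul _ ((p ^ x.2) ^ x.1)]
    refine mul_le_mul (mul_le_of_le_one_right (norm_nonneg _) ?_) ?_ (norm_nonneg _)
      (norm_nonneg _)
    · rw [norm_pow, norm_pow, Real.norm_eq_abs, abs_of_pos hp0, ← pow_mul]
      exact pow_le_one₀ hp0.le hp1.le
    · rw [norm_mul, Real.norm_eq_abs (_ * _), abs_of_pos (by positivity), mul_assoc]
      exact mul_le_mul_of_nonneg_right (lp.norm_apply_le_norm two_ne_zero u _) (by positivity)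
  have hG : ∀ k : ℤ, ∑' m : ℕ, u m * kernel p r (k + (N + m)) =
      r ^ k * ∑' l, (∑' m, t l m) * (p ^ k) ^ l := by
    intro k
    simp only [← tsum_mul_right]
    rw [← Summable.tsum_comm (f := fun l m => t l m * (p ^ k) ^ l) (hpair (p ^ k)),
      ← tsum_mul_left]
    refine tsum_congr fun m => ?_
    rw [kernel_eq_tsum_kernelCoeff hp0 hp1 hr0, zpow_add₀ hr0.ne', ← tsum_mul_left, ← tsum_mul_left,
      ← tsum_mul_left]
    refine tsum_congr fun l => ?_
    simp only [t]
    rw [zpow_add₀ hp0.ne' k]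
    ring
  have hd : ∀ l, ∑' m, t l m = 0 := by
    refine eq_zero_of_tsum_mul_pow_eq_zero (y := fun n : ℕ => p ^ (N + n)) (fun y => ?_) ?_ ?_ ?_
    · simp only [← tsum_mul_right]
      exact Summable.prod (hpair y)
    · have : Tendsto (fun n : ℕ => p ^ N * p ^ n) atTop (𝓝 (p ^ N * 0)) :=
        (tendsto_pow_atTop_nhds_zero_of_lt_one hp0.le hp1).const_mul _
      simpa [zpow_add₀ hp0.ne'] using this
    · exact fun n => (zpow_pos hp0 _).ne'
    · intro n
      have := hu n
      rw [hG] at this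
      exact (mul_eq_zero.1 this).resolve_left (zpow_pos hr0 _).ne'
  rw [hG]
  simp [hd]

theorem exists_truncated_hankel {p r : ℝ} (hp0 : 0 < p) (hp1 : p < 1) (hr0 : 0 < r) (hr1 : r < 1)
    (N : ℤ) : ∃ (G : lp (fun _ : ℕ => ℝ) 2 →ₗᵢ[ℝ] lp (fun _ : ℤ => ℝ) 2)
      (T : lp (fun _ : ℕ => ℝ) 2 →L[ℝ] lp (fun _ : ℕ => ℝ) 2),
      (∀ u k, HasSum (fun n : ℕ => u n * kernel p r (k + (N + n))) (G u k)) ∧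
      (∀ u n, T u n = G u (N + (n : ℕ))) ∧ IsCompactOperator T ∧ T.IsSymmetric ∧
      ∀ u, T u = 0 → u = 0 := by
  obtain ⟨G, hG⟩ := exists_hankel_isometry hp0 hp1 hr0 hr1 N
  obtain ⟨C, hC0, hC⟩ := exists_abs_kernel_le (r := r) hp0 hp1 hr0
  obtain ⟨T, hTc, hTs, hT⟩ := exists_compact_of_column_bound
    (a := fun i j : ℕ => kernel p r (N + i + (N + j))) (D := C * r ^ (N + N)) (r := r)
    (fun i j => by ring_nf) hr0 hr1 (fun i j => by
      refine (hC _).trans_eq ?_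
      rw [show N + i + (N + j) = N + N + i + j by ring, zpow_add₀ hr0.ne', zpow_add₀ hr0.ne' (N + N),
        zpow_natCast, zpow_natCast]
      ring)
  have hTG : ∀ u (n : ℕ), T u n = G u (N + n) := fun u n => (hT u n).unique (hG u _)
  refine ⟨G, T, hG, hTG, hTc, hTs, fun u hu => ?_⟩
  have h0 : ∀ k, G u k = 0 := fun k => by
    rw [← (hG u k).tsum_eq]
    refine eq_zero_of_hankel_eq_zero hp0 hp1 hr0 hr1 N u (fun n => ?_) k
    rw [(hG u _).tsum_eq, ← hTG, hu]
    rfl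
  have : G u = 0 := lp.ext (funext h0)
  exact (map_eq_zero_iff G G.injective).1 this

/-! ### Weighted sequences -/

/-- The square root of the mass of the measure `x ^ (2 v + 1) d_q x` at `q ^ n`. -/
def wt (q v : ℝ) (n : ℤ) : ℝ := Real.sqrt (1 - q) * (q ^ (v + 1)) ^ n

/-- The values of `f` on the positive half of the lattice, weighted so that the inner product of
`L_{q,2,v}` becomes that of `ℓ²`. -/
def lift (q v : ℝ) (f : Rq q → ℝ) (n : ℤ) : ℝ := wt q v n * f (pt q n)

section Basic

variable {q v : ℝ}

theorem wt_pos (hq0 : 0 < q) (hq1 : q < 1) (v : ℝ) (n : ℤ) : 0 < wt q v n :=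
  mul_pos (Real.sqrt_pos.2 (by linarith)) (zpow_pos (Real.rpow_pos_of_pos hq0 _) _)

theorem wt_sq (hq0 : 0 < q) (hq1 : q < 1) (v : ℝ) (n : ℤ) :
    (1 - q) * (q ^ n * (q ^ n) ^ (2 * v + 1)) = wt q v n ^ 2 := by
  rw [wt, mul_pow, Real.sq_sqrt (by linarith)]
  congr 1
  rw [← Real.rpow_intCast, ← Real.rpow_intCast, ← Real.rpow_natCast, ← Real.rpow_mul hq0.le,
    ← Real.rpow_add hq0, ← Real.rpow_mul hq0.le, ← Real.rpow_mul hq0.le]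
  congr 1
  push_cast
  ring

theorem coe_pt (q : ℝ) (n : ℤ) : (pt q n : ℝ) = q ^ n := rfl

theorem lift_mul_lift (hq0 : 0 < q) (hq1 : q < 1) (v : ℝ) (f g : Rq q → ℝ) (n : ℤ) :
    (1 - q) * (q ^ n * (f (pt q n) * g (pt q n) * (pt q n : ℝ) ^ (2 * v + 1))) =
      lift q v f n * lift q v g n := by
  rw [coe_pt, lift, lift]
  linear_combination f (pt q n) * g (pt q n) * wt_sq hq0 hq1 v n

theorem qInner_eq_tsum (hq0 : 0 < q) (hq1 : q < 1) (v : ℝ) (f g : Rq q → ℝ) :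
    qInner q v f g = ∑' n, lift q v f n * lift q v g n := by
  rw [qInner, jacksonInf, ← tsum_mul_left]
  exact tsum_congr fun n => lift_mul_lift hq0 hq1 v f g n

theorem jackson_eq_tsum (hq0 : 0 < q) (N : ℤ) (g : Rq q → ℝ) :
    jackson q N g = ∑' n : ℕ, (1 - q) * (q ^ (N + n : ℤ) * g (pt q (N + n))) := by
  rw [jackson, ← tsum_mul_left]
  refine tsum_congr fun n => ?_
  rw [zpow_add₀ hq0.ne', zpow_natCast]
  ring

theorem qInnerOn_eq_tsum (hq0 : 0 < q) (hq1 : q < 1) (v : ℝ) (N : ℤ) (f g : Rq q → ℝ) :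
    qInnerOn q v N f g = ∑' n : ℕ, lift q v f (N + n) * lift q v g (N + n) := by
  rw [qInnerOn, jackson_eq_tsum hq0]
  exact tsum_congr fun n => lift_mul_lift hq0 hq1 v f g _

theorem memL2_iff (hq0 : 0 < q) (hq1 : q < 1) (v : ℝ) (f : Rq q → ℝ) :
    MemL2 q v f ↔ (∀ x y : Rq q, (y : ℝ) = -x → f y = f x) ∧
      Summable fun n => lift q v f n ^ 2 := by
  rw [MemL2, ← summable_mul_left_iff (show (1 - q) ≠ 0 by linarith)]
  refine and_congr_right fun _ => summable_congr fun n => ?_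
  rw [sq (lift _ _ _ _), ← lift_mul_lift hq0 hq1 v f f, sq_abs]
  ring

theorem memL2On_iff (hq0 : 0 < q) (hq1 : q < 1) (v : ℝ) (N : ℤ) (f : Rq q → ℝ) :
    MemL2On q v N f ↔ Summable fun n : ℕ => lift q v f (N + n) ^ 2 := by
  rw [MemL2On, ← summable_mul_left_iff (show (1 - q) * q ^ N ≠ 0 from
    mul_ne_zero (by linarith) (zpow_pos hq0 N).ne')]
  refine summable_congr fun n => ?_
  rw [sq (lift _ _ _ _), ← lift_mul_lift hq0 hq1 v f f, zpow_add₀ hq0.ne', zpow_natCast, sq_abs]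
  ring

theorem cqv_pos (hq0 : 0 < q) (hq1 : q < 1) (hv : -1 < v) : 0 < cqv q v := by
  have hp0 : 0 < q ^ 2 := by positivity
  have hp1 : q ^ 2 < 1 := by nlinarith
  have hw : q ^ (2 * v + 2) < 1 := Real.rpow_lt_one hq0.le hq1 (by linarith)
  exact mul_pos (one_div_pos.2 (by linarith))
    (div_pos (qPochInf_pos hp0 hp1 hw) (qPochInf_pos hp0 hp1 hp1))

/-- The constant c_{q,v} is exactly the one for which the weighted Bessel values become the kernel
with orthonormal translates. -/
theorem cqv_mul_hahnExton (hq0 : 0 < q) (hq1 : q < 1) (hv : -1 < v) (k : ℤ) :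
    cqv q v * (1 - q) * hahnExton v (q ^ k) (q ^ 2) * (q ^ (v + 1)) ^ k =
      kernel (q ^ 2) (q ^ (v + 1)) k := by
  have e1 : (q ^ 2) ^ (v + 1) = (q ^ (v + 1)) ^ 2 := by
    rw [← Real.rpow_natCast, ← Real.rpow_natCast, ← Real.rpow_mul hq0.le, ← Real.rpow_mul hq0.le,
      mul_comm]
  have e2 : q ^ (2 * v + 2) = (q ^ 2) ^ (v + 1) := by
    rw [← Real.rpow_natCast, ← Real.rpow_mul hq0.le]
    congr 1
    push_cast
    ring
  have h1 : (1 - q) ≠ 0 := by linarith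
  rw [kernel_eq_zpow_mul (Real.rpow_pos_of_pos hq0 _), ← e1, ← hahnExton_zpow hq0 hq1 hv k, cqv, e2]
  field_simp

/-- The weights at k and at N + n contribute r^k and r^(N+n), which merge into the factor r^(k+N+n)
of the kernel. -/
theorem wt_mul_T_pt (hq0 : 0 < q) (hq1 : q < 1) (hv : -1 < v) (N : ℤ) (u : Rq q → ℝ) (k : ℤ) :
    wt q v k * T q v N u (pt q k) =
      ∑' n : ℕ, lift q v u (N + n) * kernel (q ^ 2) (q ^ (v + 1)) (k + (N + n)) := by
  have hr : q ^ (v + 1) ≠ 0 := (Real.rpow_pos_of_pos hq0 _).ne'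
  rw [T, jackson_eq_tsum hq0, ← tsum_mul_left, ← tsum_mul_left]
  refine tsum_congr fun n => ?_
  rw [← cqv_mul_hahnExton hq0 hq1 hv, coe_pt, coe_pt, ← zpow_add₀ hq0.ne' k, zpow_add₀ hr k, lift]
  have h := wt_sq hq0 hq1 v (N + n)
  have h1 : (1 - q) = Real.sqrt (1 - q) * Real.sqrt (1 - q) :=
    (Real.mul_self_sqrt (by linarith)).symm
  have h2 : wt q v k * wt q v (N + n) =
      (1 - q) * ((q ^ (v + 1)) ^ k * (q ^ (v + 1)) ^ (N + n : ℤ)) := by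
    rw [wt, wt]
    linear_combination -((q ^ (v + 1)) ^ k * (q ^ (v + 1)) ^ (N + n : ℤ)) * h1
  linear_combination wt q v k * cqv q v * u (pt q (N + n)) *
    hahnExton v (q ^ (k + (N + n) : ℤ)) (q ^ 2) * h +
    cqv q v * u (pt q (N + n)) * hahnExton v (q ^ (k + (N + n) : ℤ)) (q ^ 2) *
      wt q v (N + n) * h2

theorem hahnExton_neg (v z p : ℝ) : hahnExton v (-z) p = hahnExton v z p := by
  simp only [hahnExton, pow_mul, neg_sq]

theorem T_even (N : ℤ) (u : Rq q → ℝ) (x y : Rq q) (h : (y : ℝ) = -x) :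
    T q v N u y = T q v N u x := by
  simp only [T, h, neg_mul, hahnExton_neg]

/-! ### Even functions with prescribed weighted values -/

theorem exists_abs_eq_zpow (hq0 : 0 < q) (x : Rq q) : ∃ k : ℤ, |(x : ℝ)| = q ^ k := by
  obtain ⟨x, k, rfl | rfl⟩ := x
  · exact ⟨k, abs_of_pos (zpow_pos hq0 k)⟩
  · exact ⟨k, by rw [abs_neg]; exact abs_of_pos (zpow_pos hq0 k)⟩

theorem eq_of_even_of_forall_pt {f g : Rq q → ℝ} (hf : ∀ x y : Rq q, (y : ℝ) = -x → f y = f x)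
    (hg : ∀ x y : Rq q, (y : ℝ) = -x → g y = g x) (h : ∀ k, f (pt q k) = g (pt q k)) : f = g := by
  funext x
  obtain ⟨k, hk⟩ := x.2
  rcases hk with hk | hk
  · have : x = pt q k := Subtype.ext hk
    rw [this, h]
  · rw [hf (pt q k) x hk, hg (pt q k) x hk, h]

/-- The even function on `ℝ_q` with weighted values `U`. -/
def ofLift (q v : ℝ) (U : ℤ → ℝ) (x : Rq q) : ℝ :=
  U (Classical.epsilon fun k : ℤ => |(x : ℝ)| = q ^ k) /
    wt q v (Classical.epsilon fun k : ℤ => |(x : ℝ)| = q ^ k)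

theorem ofLift_apply (hq0 : 0 < q) (hq1 : q < 1) (v : ℝ) (U : ℤ → ℝ) {x : Rq q} {k : ℤ}
    (hk : |(x : ℝ)| = q ^ k) : ofLift q v U x = U k / wt q v k := by
  have h : ∃ k : ℤ, |(x : ℝ)| = q ^ k := ⟨k, hk⟩
  have hc : Classical.epsilon (fun k : ℤ => |(x : ℝ)| = q ^ k) = k :=
    zpow_right_injective₀ hq0 hq1.ne ((Classical.epsilon_spec h).symm.trans hk)
  rw [ofLift, hc]

theorem ofLift_even (q v : ℝ) (U : ℤ → ℝ) (x y : Rq q) (h : (y : ℝ) = -x) :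
    ofLift q v U y = ofLift q v U x := by
  simp only [ofLift, h, abs_neg]

theorem lift_ofLift (hq0 : 0 < q) (hq1 : q < 1) (v : ℝ) (U : ℤ → ℝ) (k : ℤ) :
    lift q v (ofLift q v U) k = U k := by
  rw [lift, ofLift_apply hq0 hq1 v U (x := pt q k) (abs_of_pos (zpow_pos hq0 k)),
    mul_div_cancel₀ _ (wt_pos hq0 hq1 v k).ne']

/-- Extension of a sequence, placed at the integers `≥ N`, by zero. -/
def extendZero (N : ℤ) (U : ℕ → ℝ) (k : ℤ) : ℝ := if N ≤ k then U (k - N).toNat else 0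

theorem extendZero_add (N : ℤ) (U : ℕ → ℝ) (n : ℕ) : extendZero N U (N + n) = U n := by
  simp [extendZero]

theorem memL2Supp_ofLift (hq0 : 0 < q) (hq1 : q < 1) (v : ℝ) (N : ℤ)
    (U : lp (fun _ : ℕ => ℝ) 2) : MemL2Supp q v N (ofLift q v (extendZero N U)) := by
  refine ⟨(memL2_iff hq0 hq1 v _).2 ⟨ofLift_even q v _, ?_⟩, fun x hx => ?_⟩
  · simp only [lift_ofLift hq0 hq1]
    have hinj : Function.Injective fun n : ℕ => N + (n : ℤ) := fun a b h => by simpa using h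
    rw [← hinj.summable_iff]
    · simpa [Function.comp_def, extendZero_add] using summable_sq_of_memℓp_two (lp.memℓp U)
    · intro k hk
      rw [extendZero, if_neg, zero_pow two_ne_zero]
      intro h
      exact hk ⟨(k - N).toNat, by simp [h]⟩
  · obtain ⟨k, hk⟩ := exists_abs_eq_zpow hq0 x
    rw [hk] at hx
    have : k < N := (zpow_lt_zpow_iff_right_of_lt_one₀ hq0 hq1).1 hx
    rw [ofLift_apply hq0 hq1 v _ hk, extendZero, if_neg (not_le.2 this), zero_div]

end Basic

/-! ### Orthonormal bases of eigenvectors -/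

section Eigenbasis

variable {E : Type*} [NormedAddCommGroup E] [InnerProductSpace ℝ E] [CompleteSpace E]
  {T : E →L[ℝ] E} {e : ℕ → E} {l : ℕ → ℝ}

theorem hasSum_inner_sq (he : Orthonormal ℝ e) (hc : ∀ x, (∀ i, inner ℝ x (e i) = 0) → x = 0)
    (U : E) : HasSum (fun i => inner ℝ U (e i) ^ 2) (‖U‖ ^ 2) := by
  have hbot : (Submodule.span ℝ (Set.range e))ᗮ = ⊥ := by
    rw [Submodule.eq_bot_iff]
    intro x hx
    exact hc x fun i => (Submodule.mem_orthogonal' _ _).1 hx _ (Submodule.subset_span ⟨i, rfl⟩)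
  have h := (HilbertBasis.mkOfOrthogonalEqBot he hbot).hasSum_inner_mul_inner U U
  rw [real_inner_self_eq_norm_sq] at h
  simpa only [HilbertBasis.coe_mkOfOrthogonalEqBot, real_inner_comm U, ← sq] using h

theorem hasSum_eigenvalue_sq_mul_inner_sq (hT : T.IsSymmetric) (he : Orthonormal ℝ e)
    (hl : ∀ i, T (e i) = l i • e i) (hc : ∀ x, (∀ i, inner ℝ x (e i) = 0) → x = 0) (U : E) :
    HasSum (fun i => l i ^ 2 * inner ℝ U (e i) ^ 2) (‖T U‖ ^ 2) := by
  have h : ∀ i, inner ℝ (T U) (e i) ^ 2 = l i ^ 2 * inner ℝ U (e i) ^ 2 := fun i => by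
    have : inner ℝ (T U) (e i) = inner ℝ U (T (e i)) := hT U (e i)
    rw [this, hl, inner_smul_right, mul_pow]
  simpa only [h] using hasSum_inner_sq he hc (T U)

theorem norm_sq_ratio_of_span (hT : T.IsSymmetric) (he : Orthonormal ℝ e)
    (hl : ∀ i, T (e i) = l i • e i) (hc : ∀ x, (∀ i, inner ℝ x (e i) = 0) → x = 0)
    (hord : ∀ i j, i ≤ j → |l j| ≤ |l i|) {n : ℕ} {U : E} (hU0 : U ≠ 0)
    (hU : ∀ i, n < i → inner ℝ U (e i) = 0) :
    ‖T U‖ ^ 2 / ‖U‖ ^ 2 = (∑ i ∈ Finset.range (n + 1), l i ^ 2 * inner ℝ U (e i) ^ 2) /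
        (∑ i ∈ Finset.range (n + 1), inner ℝ U (e i) ^ 2) ∧
      l n ^ 2 ≤ ‖T U‖ ^ 2 / ‖U‖ ^ 2 := by
  have h0 : ∀ i ∉ Finset.range (n + 1), inner ℝ U (e i) = 0 := fun i hi => by
    rw [Finset.mem_range] at hi
    exact hU i (by omega)
  have h1 : ‖U‖ ^ 2 = ∑ i ∈ Finset.range (n + 1), inner ℝ U (e i) ^ 2 :=
    (hasSum_inner_sq he hc U).unique (hasSum_sum_of_ne_finset_zero fun i hi => by
      rw [h0 i hi, zero_pow two_ne_zero])
  have h2 : ‖T U‖ ^ 2 = ∑ i ∈ Finset.range (n + 1), l i ^ 2 * inner ℝ U (e i) ^ 2 :=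
    (hasSum_eigenvalue_sq_mul_inner_sq hT he hl hc U).unique
      (hasSum_sum_of_ne_finset_zero fun i hi => by rw [h0 i hi, zero_pow two_ne_zero, mul_zero])
  refine ⟨by rw [h1, h2], ?_⟩
  rw [le_div_iff₀ (by positivity), h1, h2, Finset.mul_sum]
  refine Finset.sum_le_sum fun i hi => mul_le_mul_of_nonneg_right ?_ (sq_nonneg _)
  rw [Finset.mem_range] at hi
  exact sq_le_sq.2 (hord i n (by omega))

/-- Parseval for U and for TU, with the first n terms zero; the remaining l i ^ 2 are at most l n ^
2. For n = 0 the orthogonality condition is empty, which gives the global maximum. -/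
theorem norm_sq_ratio_of_orthogonal (hT : T.IsSymmetric) (he : Orthonormal ℝ e)
    (hl : ∀ i, T (e i) = l i • e i) (hc : ∀ x, (∀ i, inner ℝ x (e i) = 0) → x = 0)
    (hord : ∀ i j, i ≤ j → |l j| ≤ |l i|) {n : ℕ} {U : E} (hU0 : U ≠ 0)
    (hU : ∀ i, i < n → inner ℝ U (e i) = 0) :
    (Summable fun i => l (n + i) ^ 2 * inner ℝ U (e (n + i)) ^ 2) ∧
      (Summable fun i => inner ℝ U (e (n + i)) ^ 2) ∧
      ‖T U‖ ^ 2 / ‖U‖ ^ 2 = (∑' i, l (n + i) ^ 2 * inner ℝ U (e (n + i)) ^ 2) /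
        (∑' i, inner ℝ U (e (n + i)) ^ 2) ∧
      ‖T U‖ ^ 2 / ‖U‖ ^ 2 ≤ l n ^ 2 := by
  have h1 : HasSum (fun i => inner ℝ U (e (n + i)) ^ 2) (‖U‖ ^ 2) := by
    simp only [add_comm n]
    rw [hasSum_nat_add_iff (f := fun i => inner ℝ U (e i) ^ 2) n, Finset.sum_eq_zero, add_zero]
    · exact hasSum_inner_sq he hc U
    · intro i hi
      rw [hU i (Finset.mem_range.1 hi), zero_pow two_ne_zero]
  have h2 : HasSum (fun i => l (n + i) ^ 2 * inner ℝ U (e (n + i)) ^ 2) (‖T U‖ ^ 2) := by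
    simp only [add_comm n]
    rw [hasSum_nat_add_iff (f := fun i => l i ^ 2 * inner ℝ U (e i) ^ 2) n, Finset.sum_eq_zero,
      add_zero]
    · exact hasSum_eigenvalue_sq_mul_inner_sq hT he hl hc U
    · intro i hi
      rw [hU i (Finset.mem_range.1 hi), zero_pow two_ne_zero, mul_zero]
  refine ⟨h2.summable, h1.summable, by rw [h1.tsum_eq, h2.tsum_eq], ?_⟩
  rw [div_le_iff₀ (by positivity)]
  refine hasSum_le (fun i => ?_) h2 (h1.mul_left (l n ^ 2))
  exact mul_le_mul_of_nonneg_right (sq_le_sq.2 (hord n (n + i) (by omega))) (sq_nonneg _)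

end Eigenbasis

/-! ### Functions represented by `ℓ²` sequences -/

/-- `G` is the finite Hankel transform in weighted coordinates, and `T` its truncation. -/
structure IsHankelPair (q v : ℝ) (N : ℤ)
    (G : lp (fun _ : ℕ => ℝ) 2 →ₗᵢ[ℝ] lp (fun _ : ℤ => ℝ) 2)
    (T : lp (fun _ : ℕ => ℝ) 2 →L[ℝ] lp (fun _ : ℕ => ℝ) 2) : Prop where
  hasSum : ∀ u k, HasSum (fun n : ℕ => u n * kernel (q ^ 2) (q ^ (v + 1)) (k + (N + n))) (G u k)
  trunc : ∀ u (n : ℕ), T u n = G u (N + n)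
  compact : IsCompactOperator T
  symm : T.IsSymmetric
  inj : ∀ u, T u = 0 → u = 0

/-- `f` is even, and its weighted values are those of `G U`. -/
def Represents (q v : ℝ) (G : lp (fun _ : ℕ => ℝ) 2 →ₗᵢ[ℝ] lp (fun _ : ℤ => ℝ) 2)
    (f : Rq q → ℝ) (U : lp (fun _ : ℕ => ℝ) 2) : Prop :=
  (∀ x y : Rq q, (y : ℝ) = -x → f y = f x) ∧ ∀ k, lift q v f k = G U k

section Hankel

variable {q v : ℝ} {N : ℤ} {G : lp (fun _ : ℕ => ℝ) 2 →ₗᵢ[ℝ] lp (fun _ : ℤ => ℝ) 2}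
  {T' : lp (fun _ : ℕ => ℝ) 2 →L[ℝ] lp (fun _ : ℕ => ℝ) 2}

theorem exists_isHankelPair (hq0 : 0 < q) (hq1 : q < 1) (hv : -1 < v) (N : ℤ) :
    ∃ G T', IsHankelPair q v N G T' := by
  obtain ⟨G, T', h1, h2, h3, h4, h5⟩ := exists_truncated_hankel (p := q ^ 2) (r := q ^ (v + 1))
    (by positivity) (by nlinarith) (Real.rpow_pos_of_pos hq0 _)
    (Real.rpow_lt_one hq0.le hq1 (by linarith)) N
  exact ⟨G, T', h1, h2, h3, h4, h5⟩

theorem IsHankelPair.wt_mul_T_pt (hG : IsHankelPair q v N G T') (hq0 : 0 < q) (hq1 : q < 1)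
    (hv : -1 < v) {u : Rq q → ℝ} {U : lp (fun _ : ℕ => ℝ) 2}
    (hU : ∀ n : ℕ, lift q v u (N + n) = U n) (k : ℤ) :
    wt q v k * T q v N u (pt q k) = G U k := by
  rw [QProlate.wt_mul_T_pt hq0 hq1 hv, ← (hG.hasSum U k).tsum_eq]
  simp only [hU]

theorem exists_lp_of_memL2On (hq0 : 0 < q) (hq1 : q < 1) {u : Rq q → ℝ} (hu : MemL2On q v N u) :
    ∃ U : lp (fun _ : ℕ => ℝ) 2, ∀ n : ℕ, lift q v u (N + n) = U n :=
  ⟨⟨fun n => lift q v u (N + n), memℓp_two_of_summable_sq ((memL2On_iff hq0 hq1 v N u).1 hu)⟩,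
    fun _ => rfl⟩

theorem memL2On_of_lift_eq (hq0 : 0 < q) (hq1 : q < 1) {u : Rq q → ℝ}
    {U : lp (fun _ : ℕ => ℝ) 2} (hU : ∀ n : ℕ, lift q v u (N + n) = U n) : MemL2On q v N u := by
  rw [memL2On_iff hq0 hq1]
  simp only [hU]
  exact summable_sq_of_memℓp_two (lp.memℓp U)

theorem qInnerOn_eq_inner (hq0 : 0 < q) (hq1 : q < 1) {u w : Rq q → ℝ}
    {U W : lp (fun _ : ℕ => ℝ) 2} (hU : ∀ n : ℕ, lift q v u (N + n) = U n)
    (hW : ∀ n : ℕ, lift q v w (N + n) = W n) : qInnerOn q v N u w = inner ℝ U W := by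
  rw [qInnerOn_eq_tsum hq0 hq1, inner_lp_eq_tsum]
  simp only [hU, hW]

theorem IsHankelPair.isEigenfunction_iff (hG : IsHankelPair q v N G T') (hq0 : 0 < q)
    (hq1 : q < 1) (hv : -1 < v) {u : Rq q → ℝ} {U : lp (fun _ : ℕ => ℝ) 2}
    (hU : ∀ n : ℕ, lift q v u (N + n) = U n) (μ : ℝ) :
    IsEigenfunction q v N μ u ↔ U ≠ 0 ∧ T' U = μ • U := by
  have hex : ∀ s : ℤ, N ≤ s → ∃ n : ℕ, s = N + n := fun s hs =>
    ⟨(s - N).toNat, by rw [Int.toNat_of_nonneg (by omega)]; ring⟩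
  refine ⟨fun h => ⟨?_, ?_⟩, fun h => ⟨memL2On_of_lift_eq hq0 hq1 hU, ?_, ?_⟩⟩
  · rintro rfl
    obtain ⟨s, hs, hne⟩ := h.2.1
    obtain ⟨n, rfl⟩ := hex s hs
    have := hU n
    rw [lift, lp.coeFn_zero, Pi.zero_apply] at this
    exact hne ((mul_eq_zero.1 this).resolve_left (wt_pos hq0 hq1 v _).ne')
  · refine lp.ext (funext fun n => ?_)
    rw [hG.trunc, ← hG.wt_mul_T_pt hq0 hq1 hv hU, h.2.2 _ (by omega), lp.coeFn_smul, Pi.smul_apply,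
      ← hU, lift, smul_eq_mul]
    ring
  · by_contra! hcon
    refine h.1 (lp.ext (funext fun n => ?_))
    rw [← hU, lift, hcon _ (by omega), mul_zero]
    rfl
  · intro s hs
    obtain ⟨n, rfl⟩ := hex s hs
    refine mul_left_cancel₀ (wt_pos hq0 hq1 v (N + n)).ne' ?_
    rw [hG.wt_mul_T_pt hq0 hq1 hv hU, ← hG.trunc, h.2, lp.coeFn_smul, Pi.smul_apply, ← hU, lift,
      smul_eq_mul]
    ring

theorem Represents.qInner_eq (hq0 : 0 < q) (hq1 : q < 1) {f g : Rq q → ℝ}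
    {U W : lp (fun _ : ℕ => ℝ) 2} (hf : Represents q v G f U) (hg : Represents q v G g W) :
    qInner q v f g = inner ℝ U W := by
  rw [qInner_eq_tsum hq0 hq1, ← G.inner_map_map, inner_lp_eq_tsum]
  simp only [hf.2, hg.2]

theorem Represents.memL2 (hq0 : 0 < q) (hq1 : q < 1) {f : Rq q → ℝ}
    {U : lp (fun _ : ℕ => ℝ) 2} (hf : Represents q v G f U) : MemL2 q v f := by
  refine (memL2_iff hq0 hq1 v f).2 ⟨hf.1, ?_⟩
  simp only [hf.2]
  exact summable_sq_of_memℓp_two (lp.memℓp _)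

theorem Represents.eq_zero_iff (hq0 : 0 < q) (hq1 : q < 1) {f : Rq q → ℝ}
    {U : lp (fun _ : ℕ => ℝ) 2} (hf : Represents q v G f U) : f = 0 ↔ U = 0 := by
  constructor
  · rintro rfl
    refine (map_eq_zero_iff G G.injective).1 (lp.ext (funext fun k => ?_))
    rw [← hf.2 k, lift, Pi.zero_apply, mul_zero]
    rfl
  · rintro rfl
    refine eq_of_even_of_forall_pt hf.1 (fun _ _ _ => rfl) fun k => ?_
    have := hf.2 k
    rw [map_zero, lp.coeFn_zero, Pi.zero_apply, lift] at this
    exact (mul_eq_zero.1 this).resolve_left (wt_pos hq0 hq1 v k).ne'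

/-- The values of GU on [0,a]_q form TU, which gives the numerator; G is an isometry, which gives
the denominator. -/
theorem IsHankelPair.theta_eq (hG : IsHankelPair q v N G T') (hq0 : 0 < q) (hq1 : q < 1)
    {f : Rq q → ℝ} {U : lp (fun _ : ℕ => ℝ) 2} (hf : Represents q v G f U) :
    theta q v N f = ‖T' U‖ ^ 2 / ‖U‖ ^ 2 := by
  have h1 : (jackson q N fun x => f x ^ 2 * (x : ℝ) ^ (2 * v + 1)) = ‖T' U‖ ^ 2 := by
    have : (jackson q N fun x => f x ^ 2 * (x : ℝ) ^ (2 * v + 1)) = qInnerOn q v N f f := by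
      simp only [sq, qInnerOn]
    rw [this, ← real_inner_self_eq_norm_sq]
    have hU : ∀ n : ℕ, lift q v f (N + n) = T' U n := fun n => by rw [hf.2, hG.trunc]
    exact qInnerOn_eq_inner hq0 hq1 hU hU
  have h2 : (jacksonInf q fun x => |f x| ^ 2 * (x : ℝ) ^ (2 * v + 1)) = ‖U‖ ^ 2 := by
    have : (jacksonInf q fun x => |f x| ^ 2 * (x : ℝ) ^ (2 * v + 1)) = qInner q v f f := by
      simp only [sq_abs]
      simp only [sq, qInner]
    rw [this, ← real_inner_self_eq_norm_sq]
    exact hf.qInner_eq hq0 hq1 hf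
  rw [theta, qNorm, h1, h2, Real.sq_sqrt (sq_nonneg _)]

theorem IsHankelPair.mem_PW_iff (hG : IsHankelPair q v N G T') (hq0 : 0 < q) (hq1 : q < 1)
    (hv : -1 < v) (f : Rq q → ℝ) : f ∈ PW q v N ↔ ∃ U, Represents q v G f U := by
  have hc := cqv_pos hq0 hq1 hv
  have hPW : ∀ u : Rq q → ℝ, (∀ x : Rq q, f x = jackson q N fun t =>
      u t * hahnExton v ((x : ℝ) * t) (q ^ 2) * (t : ℝ) ^ (2 * v + 1)) ↔
      ∀ x, cqv q v * f x = T q v N u x := fun u =>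
    forall_congr' fun x => by rw [T, mul_right_inj' hc.ne']
  constructor
  · rintro ⟨u, hu, hf⟩
    rw [hPW] at hf
    have hinj : Function.Injective fun n : ℕ => N + (n : ℤ) := fun a b h => by simpa using h
    have hu2 : MemL2On q v N u := (memL2On_iff hq0 hq1 v N u).2
      (((memL2_iff hq0 hq1 v u).1 hu.1).2.comp_injective hinj)
    obtain ⟨U, hU⟩ := exists_lp_of_memL2On hq0 hq1 hu2
    -- The Paley-Wiener integral lacks the factor c_{q,v} contained in G, hence the rescaling; the
    -- converse rescales by c_{q,v}.
    refine ⟨(cqv q v)⁻¹ • U, fun x y hxy => ?_, fun k => ?_⟩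
    · refine mul_left_cancel₀ hc.ne' ?_
      rw [hf, hf, T_even N u x y hxy]
    · rw [map_smul, lp.coeFn_smul, Pi.smul_apply, ← hG.wt_mul_T_pt hq0 hq1 hv hU, ← hf, lift,
        smul_eq_mul]
      field_simp
  · rintro ⟨U, hf⟩
    set u := ofLift q v (extendZero N ⇑(cqv q v • U))
    have hU : ∀ n : ℕ, lift q v u (N + n) = (cqv q v • U) n := fun n => by
      rw [lift_ofLift hq0 hq1, extendZero_add]
    refine ⟨u, memL2Supp_ofLift hq0 hq1 v N _, (hPW u).2 (congrFun
      (eq_of_even_of_forall_pt (fun x y hxy => ?_) (T_even N u) fun k => ?_))⟩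
    · rw [hf.1 x y hxy]
    · refine mul_left_cancel₀ (wt_pos hq0 hq1 v k).ne' ?_
      rw [hG.wt_mul_T_pt hq0 hq1 hv hU, map_smul, lp.coeFn_smul, Pi.smul_apply, ← hf.2, lift,
        smul_eq_mul]
      ring

theorem represents_ofLift (hq0 : 0 < q) (hq1 : q < 1) (U : lp (fun _ : ℕ => ℝ) 2) :
    Represents q v G (ofLift q v (G U)) U :=
  ⟨ofLift_even q v _, lift_ofLift hq0 hq1 v _⟩

theorem not_finiteDimensional_lp : ¬ FiniteDimensional ℝ (lp (fun _ : ℕ => ℝ) 2) := by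
  intro h
  have hli := (default : HilbertBasis ℕ ℝ (lp (fun _ : ℕ => ℝ) 2)).orthonormal.linearIndependent
  exact not_finite_iff_infinite.2 inferInstance hli.finite_of_isNoetherian

theorem IsHankelPair.exists_isProlateSystem (hG : IsHankelPair q v N G T') (hq0 : 0 < q)
    (hq1 : q < 1) (hv : -1 < v) :
    ∃ (lam : ℕ → ℝ) (ψ : ℕ → Rq q → ℝ), IsProlateSystem q v N lam ψ := by
  obtain ⟨e, l, he, hl, hord, hcompl⟩ :=
    exists_sorted_eigenvectors hG.compact hG.symm hG.inj not_finiteDimensional_lp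
  have hl0 : ∀ i, l i ≠ 0 := fun i h0 => by
    have := hl i
    rw [h0, zero_smul] at this
    exact he.ne_zero i (hG.inj _ this)
  have hrep : ∀ i, Represents q v G (ofLift q v (G (e i))) (e i) :=
    fun i => represents_ofLift hq0 hq1 (e i)
  -- On [0,a]_q the function G e_i has coordinates T e_i = l i • e_i and not e_i; it is on all of
  -- ℝ_q that its norm is 1.
  have hlift : ∀ i (n : ℕ), lift q v (ofLift q v (G (e i))) (N + n) = (l i • e i) n := fun i n => by
    rw [(hrep i).2, ← hG.trunc, hl]
  refine ⟨l, fun i => ofLift q v (G (e i)), ⟨fun i => ?_, fun i j hij => ?_, fun μ u hu => ?_, hord,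
    fun i => ?_, fun i => ?_⟩⟩
  · rw [hG.isEigenfunction_iff hq0 hq1 hv (hlift i)]
    exact ⟨smul_ne_zero (hl0 i) (he.ne_zero i), by rw [map_smul, hl]⟩
  · rw [qInnerOn_eq_inner hq0 hq1 (hlift i) (hlift j), inner_smul_left, inner_smul_right, he.2 hij,
      mul_zero, mul_zero]
  · obtain ⟨U, hU⟩ := exists_lp_of_memL2On hq0 hq1 hu.1
    have hU0 := ((hG.isEigenfunction_iff hq0 hq1 hv hU μ).1 hu).1
    by_contra! hcon
    refine hU0 (hcompl U fun i => ?_)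
    have := hcon i
    rw [qInnerOn_eq_inner hq0 hq1 hU (hlift i), inner_smul_right] at this
    exact (mul_eq_zero.1 this).resolve_left (hl0 i)
  · refine congrFun (eq_of_even_of_forall_pt (hrep i).1 (fun x y hxy => ?_) fun k => ?_)
    · rw [T_even N _ x y hxy]
    · refine mul_left_cancel₀ (wt_pos hq0 hq1 v k).ne' ?_
      rw [mul_left_comm, hG.wt_mul_T_pt hq0 hq1 hv (hlift i), map_smul, lp.coeFn_smul,
        Pi.smul_apply, ← (hrep i).2, lift, smul_eq_mul, ← mul_assoc, one_div_mul_cancel (hl0 i),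
        one_mul]
  · rw [(hrep i).qInner_eq hq0 hq1 (hrep i), real_inner_self_eq_norm_sq, he.1, one_pow]

theorem IsHankelPair.exists_eigenbasis (hG : IsHankelPair q v N G T') (hq0 : 0 < q)
    (hq1 : q < 1) (hv : -1 < v) {lam : ℕ → ℝ} {ψ : ℕ → Rq q → ℝ}
    (hψ : IsProlateSystem q v N lam ψ) :
    ∃ e : ℕ → lp (fun _ : ℕ => ℝ) 2, Orthonormal ℝ e ∧ (∀ i, T' (e i) = lam i • e i) ∧
      (∀ x, (∀ i, inner ℝ x (e i) = 0) → x = 0) ∧ ∀ i, Represents q v G (ψ i) (e i) := by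
  choose W hW using fun i => exists_lp_of_memL2On hq0 hq1 (hψ.eigen i).1
  have hl0 : ∀ i, lam i ≠ 0 := fun i h0 => by
    obtain ⟨s, -, hs⟩ := (hψ.eigen i).2.1
    -- With lam i = 0 the convention 1 / 0 = 0 would make ψ i vanish identically.
    exact hs (by rw [hψ.extend, h0, div_zero, zero_mul])
  have hWe := fun i => ((hG.isEigenfunction_iff hq0 hq1 hv (hW i) (lam i)).1 (hψ.eigen i)).2
  have hrep : ∀ i, Represents q v G (ψ i) ((lam i)⁻¹ • W i) := fun i => by
    refine ⟨fun x y hxy => ?_, fun k => ?_⟩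
    · rw [hψ.extend, T_even N _ x y hxy, ← hψ.extend]
    · rw [map_smul, lp.coeFn_smul, Pi.smul_apply, ← hG.wt_mul_T_pt hq0 hq1 hv (hW i), lift,
        hψ.extend, smul_eq_mul, one_div, mul_left_comm]
  have heig : ∀ i, T' ((lam i)⁻¹ • W i) = lam i • (lam i)⁻¹ • W i := fun i => by
    rw [map_smul, hWe, smul_comm]
  refine ⟨fun i => (lam i)⁻¹ • W i, ⟨fun i => ?_, fun i j hij => ?_⟩, heig, ?_, hrep⟩
  · have := hψ.unit i
    rw [(hrep i).qInner_eq hq0 hq1 (hrep i), real_inner_self_eq_norm_sq] at this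
    exact (pow_eq_one_iff_of_nonneg (norm_nonneg _) two_ne_zero).1 this
  · have := hψ.orth i j hij
    rw [qInnerOn_eq_inner hq0 hq1 (hW i) (hW j)] at this
    simp only [inner_smul_left, inner_smul_right, this, mul_zero]
  · by_contra! hcon
    obtain ⟨x, hx, hx0⟩ := hcon
    -- The hypothesis `full` only excludes eigenfunctions orthogonal to all ψ i. It suffices: if the
    -- complement of the span is nonzero, it is T'-invariant and so contains an eigenvector.
    obtain ⟨U, μ, hU, hU1, hUμ, -⟩ := exists_eigenvector_norm_le hG.compact hG.symm hG.inj
      (Submodule.isClosed_orthogonal _)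
      ((Submodule.ne_bot_iff _).2 ⟨x, mem_orthogonal_span_range hx, hx0⟩)
      (orthogonal_invariant hG.symm (span_range_invariant heig))
    have hUl : ∀ n : ℕ, lift q v (ofLift q v (extendZero N U)) (N + n) = U n := fun n => by
      rw [lift_ofLift hq0 hq1, extendZero_add]
    have hU0 : U ≠ 0 := by
      rintro rfl
      rw [norm_zero] at hU1
      exact zero_ne_one hU1
    obtain ⟨i, hi⟩ := hψ.full μ _ ((hG.isEigenfunction_iff hq0 hq1 hv hUl μ).2 ⟨hU0, hUμ⟩)
    refine hi ?_
    rw [qInnerOn_eq_inner hq0 hq1 hUl (hW i)]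
    have h := (Submodule.mem_orthogonal' _ _).1 hU _ (Submodule.subset_span ⟨i, rfl⟩)
    rw [inner_smul_right] at h
    exact (mul_eq_zero.1 h).resolve_left (inv_ne_zero (hl0 i))

theorem exists_represents_of_mem_span {e : ℕ → lp (fun _ : ℕ => ℝ) 2} {ψ : ℕ → Rq q → ℝ}
    (hrep : ∀ i, Represents q v G (ψ i) (e i)) {n : ℕ} {f : Rq q → ℝ}
    (hf : f ∈ Submodule.span ℝ (ψ '' Set.Iic n)) :
    ∃ U ∈ Submodule.span ℝ (e '' Set.Iic n), Represents q v G f U := by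
  induction hf using Submodule.span_induction with
  | mem f hf =>
    obtain ⟨i, hi, rfl⟩ := hf
    exact ⟨e i, Submodule.subset_span ⟨i, hi, rfl⟩, hrep i⟩
  | zero =>
    refine ⟨0, Submodule.zero_mem _, fun _ _ _ => rfl, fun k => ?_⟩
    rw [map_zero, lp.coeFn_zero, Pi.zero_apply, lift, Pi.zero_apply, mul_zero]
  | add f g _ _ hf hg =>
    obtain ⟨U, hU, hfU⟩ := hf
    obtain ⟨W, hW, hgW⟩ := hg
    refine ⟨U + W, Submodule.add_mem _ hU hW, fun x y hxy => ?_, fun k => ?_⟩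
    · rw [Pi.add_apply, Pi.add_apply, hfU.1 x y hxy, hgW.1 x y hxy]
    · rw [map_add, lp.coeFn_add, Pi.add_apply, ← hfU.2, ← hgW.2, lift, lift, lift, Pi.add_apply,
        mul_add]
  | smul c f _ hf =>
    obtain ⟨U, hU, hfU⟩ := hf
    refine ⟨c • U, Submodule.smul_mem _ c hU, fun x y hxy => ?_, fun k => ?_⟩
    · rw [Pi.smul_apply, Pi.smul_apply, hfU.1 x y hxy]
    · rw [map_smul, lp.coeFn_smul, Pi.smul_apply, ← hfU.2, lift, lift, Pi.smul_apply, smul_eq_mul,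
        smul_eq_mul, mul_left_comm]

theorem inner_eq_zero_of_mem_span {E : Type*} [NormedAddCommGroup E] [InnerProductSpace ℝ E]
    {e : ℕ → E} (he : Orthonormal ℝ e) {n i : ℕ} (hi : n < i) {U : E}
    (hU : U ∈ Submodule.span ℝ (e '' Set.Iic n)) : inner ℝ U (e i) = 0 := by
  induction hU using Submodule.span_induction with
  | mem u hu =>
    obtain ⟨j, hj, rfl⟩ := hu
    exact he.2 (lt_of_le_of_lt hj hi).ne
  | zero => simp
  | add u w _ _ h1 h2 => rw [inner_add_left, h1, h2, add_zero]
  | smul c u _ h => rw [inner_smul_left, h, mul_zero]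

end Hankel

end QProlate

end

/-! ### The variational properties of the prolate functions -/

theorem proposition7 (q v : ℝ) (hq0 : 0 < q) (hq1 : q < 1) (hv : -1 < v) (N : ℤ) :
    -- the prolate functions exist, and the Paley-Wiener functions have finite norm
    (∃ (lam : ℕ → ℝ) (ψ : ℕ → QProlate.Rq q → ℝ), QProlate.IsProlateSystem q v N lam ψ) ∧
    (∀ f ∈ QProlate.PW q v N, QProlate.MemL2 q v f) ∧
    ∀ (lam : ℕ → ℝ) (ψ : ℕ → QProlate.Rq q → ℝ), QProlate.IsProlateSystem q v N lam ψ →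
      -- the maximum of the concentration index is attained at `ψ 0` and equals `(lam 0)²`
      (ψ 0 ∈ QProlate.PW q v N ∧ ψ 0 ≠ 0 ∧ QProlate.theta q v N (ψ 0) = lam 0 ^ 2 ∧
        ∀ f ∈ QProlate.PW q v N, f ≠ 0 →
          QProlate.theta q v N f ≤ QProlate.theta q v N (ψ 0)) ∧
      -- the span of `ψ 0, …, ψ n`
      (∀ n : ℕ, ∀ f ∈ Submodule.span ℝ (ψ '' Set.Iic n), f ≠ 0 →
        f ∈ QProlate.PW q v N ∧
        QProlate.theta q v N f =
          (∑ i ∈ Finset.range (n + 1), lam i ^ 2 * QProlate.qInner q v f (ψ i) ^ 2) /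
            (∑ i ∈ Finset.range (n + 1), QProlate.qInner q v f (ψ i) ^ 2) ∧
        lam n ^ 2 ≤ QProlate.theta q v N f) ∧
      -- its orthogonal complement in the Paley-Wiener space
      (∀ n : ℕ, ∀ f ∈ QProlate.PW q v N, f ≠ 0 →
        (∀ g ∈ Submodule.span ℝ (ψ '' Set.Iic n), QProlate.qInner q v f g = 0) →
        (Summable fun i : ℕ =>
          lam (n + 1 + i) ^ 2 * QProlate.qInner q v f (ψ (n + 1 + i)) ^ 2) ∧
        (Summable fun i : ℕ => QProlate.qInner q v f (ψ (n + 1 + i)) ^ 2) ∧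
        QProlate.theta q v N f =
          (∑' i : ℕ, lam (n + 1 + i) ^ 2 * QProlate.qInner q v f (ψ (n + 1 + i)) ^ 2) /
            (∑' i : ℕ, QProlate.qInner q v f (ψ (n + 1 + i)) ^ 2) ∧
        QProlate.theta q v N f ≤ lam (n + 1) ^ 2) := by
  obtain ⟨G, T', hG⟩ := QProlate.exists_isHankelPair hq0 hq1 hv N
  refine ⟨hG.exists_isProlateSystem hq0 hq1 hv, fun f hf => ?_, fun lam ψ hψ => ?_⟩
  · obtain ⟨U, hU⟩ := (hG.mem_PW_iff hq0 hq1 hv f).1 hf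
    exact hU.memL2 hq0 hq1
  obtain ⟨e, he, hl, hc, hrep⟩ := hG.exists_eigenbasis hq0 hq1 hv hψ
  have hord := hψ.order
  have hθ0 : QProlate.theta q v N (ψ 0) = lam 0 ^ 2 := by
    rw [hG.theta_eq hq0 hq1 (hrep 0), hl, norm_smul, he.1, Real.norm_eq_abs]
    simp
  refine ⟨⟨(hG.mem_PW_iff hq0 hq1 hv _).2 ⟨_, hrep 0⟩, ?_, hθ0, fun f hf hf0 => ?_⟩,
    fun n f hf hf0 => ?_, fun n f hf hf0 hperp => ?_⟩
  · exact fun h => he.ne_zero 0 (((hrep 0).eq_zero_iff hq0 hq1).1 h)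
  · obtain ⟨U, hU⟩ := (hG.mem_PW_iff hq0 hq1 hv f).1 hf
    have hU0 : U ≠ 0 := fun h => hf0 ((hU.eq_zero_iff hq0 hq1).2 h)
    rw [hθ0, hG.theta_eq hq0 hq1 hU]
    exact (QProlate.norm_sq_ratio_of_orthogonal hG.symm he hl hc hord (n := 0) hU0
      fun i hi => absurd hi i.not_lt_zero).2.2.2
  · obtain ⟨U, hUs, hU⟩ := QProlate.exists_represents_of_mem_span hrep hf
    have hU0 : U ≠ 0 := fun h => hf0 ((hU.eq_zero_iff hq0 hq1).2 h)
    rw [hG.theta_eq hq0 hq1 hU]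
    simp only [hU.qInner_eq hq0 hq1 (hrep _)]
    exact ⟨(hG.mem_PW_iff hq0 hq1 hv f).2 ⟨U, hU⟩,
      QProlate.norm_sq_ratio_of_span hG.symm he hl hc hord hU0
        fun i hi => QProlate.inner_eq_zero_of_mem_span he hi hUs⟩
  · obtain ⟨U, hU⟩ := (hG.mem_PW_iff hq0 hq1 hv f).1 hf
    have hU0 : U ≠ 0 := fun h => hf0 ((hU.eq_zero_iff hq0 hq1).2 h)
    rw [hG.theta_eq hq0 hq1 hU]
    simp only [hU.qInner_eq hq0 hq1 (hrep _)]
    refine QProlate.norm_sq_ratio_of_orthogonal hG.symm he hl hc hord hU0 fun i hi => ?_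
    rw [← hU.qInner_eq hq0 hq1 (hrep i)]
    exact hperp _ (Submodule.subset_span ⟨i, Nat.lt_succ_iff.1 hi, rfl⟩)
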